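/- Let $X$ be a topological space (for instance a connected CW-complex) and $A$ an abelian group; $C^*$ and $H^*$ denote singular cochains and cohomology. Let $PX=C([0,1],X)$ be the path space with end point map $\pi\colon PX\to X\times X$, $\pi(\gamma)=(\gamma(0),\gamma(1))$, let $LX=\{\gamma\in PX\mid \gamma(0)=\gamma(1)\}$, and let $r_1,r_2\colon LX\to PX$ be $r_1(\gamma)(t)=\gamma(t/2)$, $r_2(\gamma)(t)=\gamma(1-t/2)$. Let the fiberwise join $$P_2X=\big((LX\times[1,2])\amalg (PX\times\{1\})\amalg (PX\times\{2\})\big)/\!\sim,\qquad (\gamma,j)\sim (r_j(\gamma),j)\quad(\gamma\in LX,\ j=1,2),$$ be the double mapping cylinder of $r_1$ and $r_2$, with the map $\pi_2\colon P_2X\to X\times X$ given by $\pi_2[\gamma,t]=(\gamma(0),\gamma(\tfrac12))$ for $\gamma\in LX$ and $\pi_2[\gamma,j]=(\gamma(0),\gamma(1))$ for $\gamma\in PX$. Let $q\colon P_2X\to[1,2]$, $q[\gamma,t]=t$, $Z(r_1)=q^{-1}[1,\tfrac32]$ and $Z(r_2)=q^{-1}[\tfrac32,2]$, with inclusions $i_k\colon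 Z(r_k)\to P_2X$; identify $LX$ with $Z(r_1)\cap Z(r_2)$ by $\gamma\mapsto[\gamma,\tfrac32]$, and let $\iota_k\colon LX\to Z(r_k)$ be the resulting inclusions. Then the decomposition $P_2X=Z(r_1)\cup Z(r_2)$ has a well-defined Mayer--Vietoris boundary homomorphism $\delta_{MV}\colon H^1(LX;A)\to H^2(P_2X;A)$ (for the difference map $\iota_1^*-\iota_2^*$): $\delta_{MV}(x)=y$ if and only if there are cocycles $a$ representing $x$ and $z$ representing $y$ and cochains $\beta_k\in C^1(Z(r_k);A)$ with $\iota_1^*\beta_1-\iota_2^*\beta_2=a$ and $\partial\beta_k=i_k^*z$ for $k=1,2$. Moreover, let $c\in C^2(X;A)$ be a cocycle, set $\overline c=\mathrm{pr}_2^*c-\mathrm{pr}_1^*c\in C^2(X\times X;A)$, and let $b_c\in C^1(PX;A)$ be any cochain with $\partial b_c=\pi^*\overline c$. Then $a_c=r_1^*b_c-r_2^*b_c\in C^1(LX;A)$ is a cocycle and $$\delta_{MV}([a_c])=\pi_2^*([\overline c])\in H^2(P_2X;A).$$ -/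

import Mathlib

noncomputable section

universe u v w

/-! ### Singular cochains and singular cohomology -/

namespace SingCoh

/-- The inclusion of the `i`-th face (opposite to the `i`-th vertex) of the standard
`(n+1)`-simplex. -/
def face (n : ℕ) (i : Fin (n + 2)) :
    C(stdSimplex ℝ (Fin (n + 1)), stdSimplex ℝ (Fin (n + 2))) :=
  ⟨stdSimplex.map i.succAbove, stdSimplex.continuous_map i.succAbove⟩

/-- Singular `n`-cochains of `X` with coefficients in `A`: functions on the set of singular
`n`-simplices, i.e. homomorphisms from the free abelian group on these simplices to `A`. -/
abbrev Cochain (X : Type u) [TopologicalSpace X] (A : Type v) (n : ℕ) : Type (max u v) :=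
  C(stdSimplex ℝ (Fin (n + 1)), X) → A

variable {X : Type u} [TopologicalSpace X] {Y : Type w} [TopologicalSpace Y]
  {A : Type v} [AddCommGroup A]

/-- The singular coboundary `(d c)(σ) = ∑ i, (-1)^i c(σ ∘ face i)`. -/
def d (X : Type u) [TopologicalSpace X] (A : Type v) [AddCommGroup A] (n : ℕ) :
    Cochain X A n →+ Cochain X A (n + 1) where
  toFun c := fun σ => ∑ i : Fin (n + 2), ((-1 : ℤ) ^ (i : ℕ)) • c (σ.comp (face n i))
  map_zero' := by
    funext σ
    simp
  map_add' c c' := by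
    funext σ
    simp [smul_add, Finset.sum_add_distrib]

/-- Pullback `f^* c` of singular cochains along a continuous map. -/
def pullback (f : C(X, Y)) (A : Type v) [AddCommGroup A] (n : ℕ) :
    Cochain Y A n →+ Cochain X A n where
  toFun c := fun σ => c (f.comp σ)
  map_zero' := rfl
  map_add' _ _ := rfl

theorem d_pullback (f : C(X, Y)) (n : ℕ) (c : Cochain Y A n) :
    d X A n (pullback f A n c) = pullback f A (n + 1) (d Y A n c) := rfl

/-- Singular cocycles. -/
def cocycles (X : Type u) [TopologicalSpace X] (A : Type v) [AddCommGroup A] (n : ℕ) :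
    AddSubgroup (Cochain X A n) :=
  (d X A n).ker

/-- Singular coboundaries. -/
def coboundaries (X : Type u) [TopologicalSpace X] (A : Type v) [AddCommGroup A] :
    (n : ℕ) → AddSubgroup (Cochain X A n)
  | 0 => ⊥
  | n + 1 => (d X A n).range

/-- Singular cohomology `H^n(X; A)`: cocycles modulo coboundaries. -/
abbrev H (X : Type u) [TopologicalSpace X] (A : Type v) [AddCommGroup A] (n : ℕ) :
    Type (max u v) :=
  cocycles X A n ⧸ (coboundaries X A n).addSubgroupOf (cocycles X A n)

/-- The cohomology class of a cocycle. -/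
def cls {n : ℕ} : cocycles X A n →+ H X A n :=
  QuotientAddGroup.mk' _

/-- Pullback of cocycles along a continuous map. -/
def cocyclesMap (f : C(X, Y)) (A : Type v) [AddCommGroup A] (n : ℕ) :
    cocycles Y A n →+ cocycles X A n :=
  ((pullback f A n).comp (cocycles Y A n).subtype).codRestrict (cocycles X A n) (by
    rintro ⟨c, hc⟩
    have hc' : d Y A n c = 0 := hc
    change d X A n (pullback f A n c) = 0
    rw [d_pullback, hc', map_zero])

/-- The homomorphism `f^* : H^n(Y; A) → H^n(X; A)` induced by a continuous map. -/
def map (f : C(X, Y)) (A : Type v) [AddCommGroup A] (n : ℕ) : H Y A n →+ H X A n :=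
  QuotientAddGroup.map _ _ (cocyclesMap f A n) (by
    rintro ⟨c, hc⟩ h
    cases n with
    | zero =>
      have h' : c = 0 := h
      subst h'
      exact (pullback f A 0).map_zero
    | succ n =>
      obtain ⟨e, he⟩ := h
      have he' : d Y A n e = c := he
      subst he'
      exact ⟨pullback f A n e, rfl⟩)

/-- `δ : H^n(L; A) → H^{n+1}(Y; A)` is the Mayer–Vietoris boundary homomorphism for the
decomposition of `Y` into two subspaces `Z₁`, `Z₂` with inclusions `i₁`, `i₂`, whose
intersection is identified with `L` by means of `ι₁ : L → Z₁` and `ι₂ : L → Z₂`; the sign is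
that of the Mayer–Vietoris sequence whose difference map is `ι₁^* - ι₂^*`.

This is the snake lemma description: `δ x = y` if and only if there are a cocycle `a` in the
class `x`, a cocycle `z` in the class `y` and cochains `β₁`, `β₂` on `Z₁`, `Z₂` with
`ι₁^* β₁ - ι₂^* β₂ = a` and `d β_k = i_k^* z` for `k = 1, 2`. Equivalently, the image of `y` in
the cohomology of the complex of cochains on the simplices that lie in `Z₁` or in `Z₂` is the
image of `x` under the connecting homomorphism of the short exact Mayer–Vietoris sequence. As
the condition is an equivalence, it determines `δ`; such a `δ` exists when singular cohomology
satisfies excision for the decomposition. -/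
def IsMayerVietorisBoundary {L Z₁ Z₂ Y : Type*} [TopologicalSpace L] [TopologicalSpace Z₁]
    [TopologicalSpace Z₂] [TopologicalSpace Y] {A : Type*} [AddCommGroup A]
    (ι₁ : C(L, Z₁)) (ι₂ : C(L, Z₂)) (i₁ : C(Z₁, Y)) (i₂ : C(Z₂, Y)) (n : ℕ)
    (δ : H L A n →+ H Y A (n + 1)) : Prop :=
  ∀ (x : H L A n) (y : H Y A (n + 1)),
    δ x = y ↔
      ∃ (a : cocycles L A n) (z : cocycles Y A (n + 1))
        (β₁ : Cochain Z₁ A n) (β₂ : Cochain Z₂ A n),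
        cls a = x ∧ cls z = y ∧
        pullback ι₁ A n β₁ - pullback ι₂ A n β₂ = (a : Cochain L A n) ∧
        d Z₁ A n β₁ = pullback i₁ A (n + 1) (z : Cochain Y A (n + 1)) ∧
        d Z₂ A n β₂ = pullback i₂ A (n + 1) (z : Cochain Y A (n + 1))

end SingCoh

/-! ### Path space, free loop space and the fiberwise join -/

namespace FiberwiseJoin

/-- The path space `PX`, with the compact-open topology. -/
abbrev PathSpace (X : Type u) [TopologicalSpace X] : Type u := C(unitInterval, X)

/-- The free loop space `LX`, a subspace of `PX`. -/
abbrev LoopSpace (X : Type u) [TopologicalSpace X] : Type u :=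
  {γ : PathSpace X // γ 0 = γ 1}

variable (X : Type u) [TopologicalSpace X]

/-- The end point map `π : PX → X × X`. -/
def endpoints : C(PathSpace X, X × X) :=
  ⟨fun γ => (γ 0, γ 1), by fun_prop⟩

/-- `ψ₁(t) = t / 2`. -/
def psi₁ : C(unitInterval, unitInterval) :=
  ⟨fun t => ⟨(t : ℝ) / 2, by
    have h0 := t.2.1
    have h1 := t.2.2
    constructor <;> linarith⟩, by fun_prop⟩

/-- `ψ₂(t) = 1 - t / 2`. -/
def psi₂ : C(unitInterval, unitInterval) :=
  ⟨fun t => ⟨1 - (t : ℝ) / 2, by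
    have h0 := t.2.1
    have h1 := t.2.2
    constructor <;> linarith⟩, by fun_prop⟩

/-- `r₁ : LX → PX`, the first half of a loop. -/
def r₁ : C(LoopSpace X, PathSpace X) :=
  ⟨fun γ => γ.1.comp psi₁, by fun_prop⟩

/-- `r₂ : LX → PX`, the second half of a loop, run backwards. -/
def r₂ : C(LoopSpace X, PathSpace X) :=
  ⟨fun γ => γ.1.comp psi₂, by fun_prop⟩

/-- The disjoint union `(LX × [1,2]) ⨿ PX ⨿ PX` (the two copies of `PX` being
`PX × {1}` and `PX × {2}`). -/
abbrev PreJoin : Type u :=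
  (LoopSpace X × Set.Icc (1 : ℝ) 2) ⊕ (PathSpace X ⊕ PathSpace X)

/-- The gluing relation of the double mapping cylinder: `(γ, 1) ∼ (r₁ γ, 1)` and
`(γ, 2) ∼ (r₂ γ, 2)`. -/
inductive Glue : PreJoin X → PreJoin X → Prop
  | left (γ : LoopSpace X) :
      Glue (Sum.inl (γ, ⟨1, by norm_num⟩)) (Sum.inr (Sum.inl (r₁ X γ)))
  | right (γ : LoopSpace X) :
      Glue (Sum.inl (γ, ⟨2, by norm_num⟩)) (Sum.inr (Sum.inr (r₂ X γ)))

/-- The fiberwise join `P₂X`: the double mapping cylinder of `r₁` and `r₂`, i.e. the quotient of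
the disjoint union by the equivalence relation generated by the gluing relation, with the
quotient topology. -/
def P₂ : Type u := Quot (Glue X)

instance : TopologicalSpace (P₂ X) := inferInstanceAs (TopologicalSpace (Quot (Glue X)))

/-- The quotient map onto `P₂X`. -/
def toP₂ : C(PreJoin X, P₂ X) := ⟨Quot.mk _, continuous_quot_mk⟩

/-- The map `π₂ : P₂X → X × X`, given by `[γ, t] ↦ (γ(0), γ(1/2))` for `γ ∈ LX` and by
`[γ, j] ↦ (γ(0), γ(1))` for `γ ∈ PX`. -/
def π₂ : C(P₂ X, X × X) :=
  ⟨Quot.lift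
    (Sum.elim (fun p : LoopSpace X × Set.Icc (1 : ℝ) 2 =>
        (p.1.1 0, p.1.1 ⟨1 / 2, by norm_num, by norm_num⟩))
      (Sum.elim (fun γ => (γ 0, γ 1)) (fun γ => (γ 0, γ 1))))
    (by
      rintro _ _ (γ | γ)
      · simp only [Sum.elim_inl, Sum.elim_inr, r₁, psi₁, ContinuousMap.coe_mk,
          ContinuousMap.comp_apply]
        congr 2
        ext
        simp
      · simp only [Sum.elim_inl, Sum.elim_inr, r₂, psi₂, ContinuousMap.coe_mk,
          ContinuousMap.comp_apply]
        congr 1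
        · rw [γ.2]
          congr 1
          ext
          simp
        · congr 1
          ext
          norm_num),
   continuous_quot_lift _ (by
    refine Continuous.sumElim ?_ (Continuous.sumElim ?_ ?_) <;> fun_prop)⟩

/-- The projection `q : P₂X → [1,2]`, `[γ, t] ↦ t` (as a real-valued function). -/
def q : C(P₂ X, ℝ) :=
  ⟨Quot.lift
    (Sum.elim (fun p : LoopSpace X × Set.Icc (1 : ℝ) 2 => (p.2 : ℝ))
      (Sum.elim (fun _ => 1) (fun _ => 2)))
    (by rintro _ _ (γ | γ) <;> rfl),
   continuous_quot_lift _ (by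
    refine Continuous.sumElim ?_ (Continuous.sumElim ?_ ?_) <;> fun_prop)⟩

/-- `Z(r₁) = q⁻¹[1, 3/2]`, the mapping cylinder of `r₁`. -/
def Z₁ : Set (P₂ X) := q X ⁻¹' Set.Icc 1 (3 / 2)

/-- `Z(r₂) = q⁻¹[3/2, 2]`, the mapping cylinder of `r₂`. -/
def Z₂ : Set (P₂ X) := q X ⁻¹' Set.Icc (3 / 2) 2

/-- The inclusion `Z(r₁) → P₂X`. -/
def i₁ : C(Z₁ X, P₂ X) := ⟨Subtype.val, continuous_subtype_val⟩

/-- The inclusion `Z(r₂) → P₂X`. -/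
def i₂ : C(Z₂ X, P₂ X) := ⟨Subtype.val, continuous_subtype_val⟩

/-- The map `LX → P₂X`, `γ ↦ [γ, 3/2]`, which identifies `LX` with `Z(r₁) ∩ Z(r₂)`. -/
def mid : C(LoopSpace X, P₂ X) :=
  (toP₂ X).comp ⟨fun γ => Sum.inl (γ, ⟨3 / 2, by norm_num, by norm_num⟩), by fun_prop⟩

/-- The inclusion `ι₁ : LX → Z(r₁)`, `γ ↦ [γ, 3/2]`. -/
def ι₁ : C(LoopSpace X, Z₁ X) :=
  ⟨fun γ => ⟨mid X γ, show (1 : ℝ) ≤ 3 / 2 ∧ (3 / 2 : ℝ) ≤ 3 / 2 by norm_num⟩, by fun_prop⟩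

/-- The inclusion `ι₂ : LX → Z(r₂)`, `γ ↦ [γ, 3/2]`. -/
def ι₂ : C(LoopSpace X, Z₂ X) :=
  ⟨fun γ => ⟨mid X γ, show (3 / 2 : ℝ) ≤ 3 / 2 ∧ (3 / 2 : ℝ) ≤ 2 by norm_num⟩, by fun_prop⟩

variable {X} {A : Type v} [AddCommGroup A]

/-- The zero-divisor cocycle `c̄ = pr₂^* c - pr₁^* c` on `X × X`. -/
def cbar {n : ℕ} (c : SingCoh.cocycles X A n) : SingCoh.cocycles (X × X) A n :=
  SingCoh.cocyclesMap ContinuousMap.snd A n c - SingCoh.cocyclesMap ContinuousMap.fst A n c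

end FiberwiseJoin

end

/-! The formula itself is short. Each mapping cylinder Z(r_k) retracts onto PX by a map ρ_k with ρ_k
∘ ι_k = r_k and π ∘ ρ_k = π₂ ∘ i_k (`exists_retraction₁`, `exists_retraction₂`). Hence the cochains
ρ_k^* b restrict on LX to r_k^* b and have coboundary i_k^* π₂^* c̄: they are a snake-lemma witness
for the pair a_c, π₂^* c̄, with no correction terms.

The work lies in the existence of the boundary homomorphism. The snake relation is additive. It is
total and single-valued once cochains that agree on LX can be glued (`exists_glue`) and the complex
of cochains vanishing on all simplices inside Z(r₁) or Z(r₂) is acyclic in positive degrees; this is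
`exists_isMayerVietorisBoundary`.

Acyclicity is excision. For an open cover it comes from iterated barycentric subdivision
(`exists_d_eq_of_isOpen`). The closed sets Z(r_k) are reached from the open sets q < 7/4 and q > 5/4
by a deformation that flattens the cylinder coordinate near 3/2 (`exists_flow`), together with the
prism operator (`exists_d_eq_of_deformation`).

Subdivision, its homotopy and the prism are built on formal tuples of points, where all identities
follow from the boundary formula for a cone. Naturality under affine maps carries them to singular
cochains by evaluation on the tuple of vertices of the standard simplex. -/

set_option linter.unusedSectionVars false

noncomputable section

/-! ### Ordered chains on tuples of points: cones, subdivision, coned homotopies -/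

namespace TupleChain

open FreeAbelianGroup

/-- Integral chains on ordered `n`-tuples of points of `K`. The index counts vertices, so that the
empty tuple provides the augmentation. -/
abbrev Chain (K : Type*) (n : ℕ) : Type _ := FreeAbelianGroup (Fin n → K)

variable {K K' K'' : Type*}

/-- The alternating sum of the faces of a tuple. -/
def bdry (K : Type*) (n : ℕ) : Chain K (n + 1) →+ Chain K n :=
  lift fun v => ∑ i : Fin (n + 1), ((-1 : ℤ) ^ (i : ℕ)) • of (v ∘ i.succAbove)

/-- The map of chains induced by a map of vertices. -/
def push (f : K → K') (n : ℕ) : Chain K n →+ Chain K' n :=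
  FreeAbelianGroup.map (f ∘ ·)

/-- The cone with apex `a`. -/
def cone (a : K) (n : ℕ) : Chain K n →+ Chain K (n + 1) :=
  FreeAbelianGroup.map (fun v => (Fin.cons a v : Fin (n + 1) → K))

@[simp] theorem bdry_of {n : ℕ} (v : Fin (n + 1) → K) :
    bdry K n (of v) = ∑ i : Fin (n + 1), ((-1 : ℤ) ^ (i : ℕ)) • of (v ∘ i.succAbove) :=
  lift_apply_of _ _

@[simp] theorem push_of (f : K → K') {n : ℕ} (v : Fin n → K) : push f n (of v) = of (f ∘ v) :=
  rfl

@[simp] theorem cone_of (a : K) {n : ℕ} (v : Fin n → K) :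
    cone a n (of v) = of (Fin.cons a v : Fin (n + 1) → K) :=
  rfl

theorem push_push (g : K' → K'') (f : K → K') (n : ℕ) (x : Chain K n) :
    push g n (push f n x) = push (g ∘ f) n x := by
  refine DFunLike.congr_fun (f := (push g n).comp (push f n)) (g := push (g ∘ f) n) ?_ x
  ext v
  rfl

theorem push_bdry (f : K → K') (n : ℕ) (x : Chain K (n + 1)) :
    push f n (bdry K n x) = bdry K' n (push f (n + 1) x) := by
  refine DFunLike.congr_fun (f := (push f n).comp (bdry K n))
    (g := (bdry K' n).comp (push f (n + 1))) ?_ x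
  ext v
  simp [map_sum, Function.comp_assoc]

theorem push_cone (f : K → K') (a : K) (n : ℕ) (x : Chain K n) :
    push f (n + 1) (cone a n x) = cone (f a) n (push f n x) := by
  refine DFunLike.congr_fun (f := (push f (n + 1)).comp (cone a n))
    (g := (cone (f a) n).comp (push f n)) ?_ x
  ext v
  simp only [AddMonoidHom.comp_apply, cone_of, push_of]
  congr 1
  funext i
  refine Fin.cases ?_ (fun j => ?_) i <;> simp

theorem bdry_cone_zero (a : K) (x : Chain K 0) : bdry K 0 (cone a 0 x) = x := by
  refine DFunLike.congr_fun (f := (bdry K 0).comp (cone a 0)) (g := AddMonoidHom.id _) ?_ x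
  ext v
  rw [AddMonoidHom.comp_apply, cone_of, bdry_of]
  simp

/-- Deleting the apex returns the base; deleting any other vertex gives the cone over a face of the
base, with the sign flipped by the index shift. So every cone operator contracts the augmented
complex. -/
theorem bdry_cone_succ (a : K) (n : ℕ) (x : Chain K (n + 1)) :
    bdry K (n + 1) (cone a (n + 1) x) = x - cone a n (bdry K n x) := by
  refine DFunLike.congr_fun (f := (bdry K (n + 1)).comp (cone a (n + 1)))
    (g := AddMonoidHom.id _ - (cone a n).comp (bdry K n)) ?_ x
  ext v
  simp only [AddMonoidHom.comp_apply, AddMonoidHom.sub_apply, AddMonoidHom.id_apply, cone_of,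
    bdry_of, map_sum, map_zsmul]
  rw [Fin.sum_univ_succ, sub_eq_add_neg, ← Finset.sum_neg_distrib]
  refine congrArg₂ (· + ·) ?_ ?_
  · rw [Fin.val_zero, pow_zero, one_smul]
    congr 1
  · refine Finset.sum_congr rfl fun i _ => ?_
    rw [Fin.val_succ, pow_succ, mul_neg_one, neg_smul]
    congr 3
    funext j
    refine Fin.cases ?_ (fun j => ?_) j <;> simp

/-- A nonempty tuple is the cone over its tail with its head as apex, so the cone formula replaces
the usual cancellation in a double sum. -/
theorem bdry_bdry (n : ℕ) (x : Chain K (n + 2)) : bdry K n (bdry K (n + 1) x) = 0 := by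
  induction n with
  | zero =>
    refine DFunLike.congr_fun (f := (bdry K 0).comp (bdry K 1)) (g := 0) ?_ x
    ext v
    rw [← Fin.cons_self_tail v, ← cone_of]
    simp only [AddMonoidHom.comp_apply]
    rw [bdry_cone_succ, map_sub, bdry_cone_zero, sub_self]
    rfl
  | succ n ih =>
    refine DFunLike.congr_fun (f := (bdry K (n + 1)).comp (bdry K (n + 2))) (g := 0) ?_ x
    ext v
    rw [← Fin.cons_self_tail v, ← cone_of]
    simp only [AddMonoidHom.comp_apply]
    rw [bdry_cone_succ, map_sub, bdry_cone_succ, ih, map_zero, sub_zero, sub_self]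
    rfl

/-- Subdivision of tuples: a tuple `v` is replaced by the cone with apex `b v` over the
subdivision of its boundary. -/
def sd (b : ∀ n, (Fin (n + 1) → K) → K) : ∀ n, Chain K n →+ Chain K n
  | 0 => AddMonoidHom.id _
  | n + 1 => lift fun v => cone (b n v) n (sd b n (bdry K n (of v)))

theorem sd_succ_of (b : ∀ n, (Fin (n + 1) → K) → K) {n : ℕ} (v : Fin (n + 1) → K) :
    sd b (n + 1) (of v) = cone (b n v) n (sd b n (bdry K n (of v))) :=
  lift_apply_of _ _

theorem bdry_sd (b : ∀ n, (Fin (n + 1) → K) → K) (n : ℕ) (x : Chain K (n + 1)) :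
    bdry K n (sd b (n + 1) x) = sd b n (bdry K n x) := by
  induction n with
  | zero =>
    refine DFunLike.congr_fun (f := (bdry K 0).comp (sd b 1))
      (g := (sd b 0).comp (bdry K 0)) ?_ x
    ext v
    simp only [AddMonoidHom.comp_apply]
    rw [sd_succ_of, bdry_cone_zero]
  | succ n ih =>
    refine DFunLike.congr_fun (f := (bdry K (n + 1)).comp (sd b (n + 2)))
      (g := (sd b (n + 1)).comp (bdry K (n + 1))) ?_ x
    ext v
    simp only [AddMonoidHom.comp_apply]
    rw [sd_succ_of, bdry_cone_succ, ih, bdry_bdry, map_zero, map_zero, sub_zero]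

theorem push_sd {b : ∀ n, (Fin (n + 1) → K) → K} {b' : ∀ n, (Fin (n + 1) → K') → K'} {f : K → K'}
    (hb : ∀ n (v : Fin (n + 1) → K), f (b n v) = b' n (f ∘ v)) (n : ℕ) (x : Chain K n) :
    push f n (sd b n x) = sd b' n (push f n x) := by
  induction n with
  | zero => rfl
  | succ n ih =>
    refine DFunLike.congr_fun (f := (push f (n + 1)).comp (sd b (n + 1)))
      (g := (sd b' (n + 1)).comp (push f (n + 1))) ?_ x
    ext v
    simp only [AddMonoidHom.comp_apply]
    rw [sd_succ_of, push_cone, ih, push_bdry, push_of, sd_succ_of, hb]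

/-- The homotopy obtained by coning off `φ`. -/
def htpy (b : ∀ n, (Fin (n + 1) → K) → K') (φ : ∀ n, Chain K n →+ Chain K' n) :
    ∀ n, Chain K n →+ Chain K' (n + 1)
  | 0 => 0
  | n + 1 => lift fun v => cone (b n v) (n + 1) (φ (n + 1) (of v) - htpy b φ n (bdry K n (of v)))

theorem htpy_succ_of (b : ∀ n, (Fin (n + 1) → K) → K') (φ : ∀ n, Chain K n →+ Chain K' n) {n : ℕ}
    (v : Fin (n + 1) → K) :
    htpy b φ (n + 1) (of v) =
      cone (b n v) (n + 1) (φ (n + 1) (of v) - htpy b φ n (bdry K n (of v))) :=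
  lift_apply_of _ _

/-- By induction `φ v - htpy (∂v)` is a cycle, so coning it off yields a chain whose boundary is
that cycle. The condition on `φ 0` starts the induction: φ must vanish on the empty tuple, that is,
on the augmentation. It is applied to differences of two augmentation-preserving chain maps. -/
theorem bdry_htpy (b : ∀ n, (Fin (n + 1) → K) → K') {φ : ∀ n, Chain K n →+ Chain K' n}
    (h₀ : φ 0 = 0) (hφ : ∀ n x, bdry K' n (φ (n + 1) x) = φ n (bdry K n x)) (n : ℕ)
    (x : Chain K (n + 1)) :
    bdry K' (n + 1) (htpy b φ (n + 1) x) = φ (n + 1) x - htpy b φ n (bdry K n x) := by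
  induction n with
  | zero =>
    refine DFunLike.congr_fun (f := (bdry K' 1).comp (htpy b φ 1))
      (g := φ 1 - (htpy b φ 0).comp (bdry K 0)) ?_ x
    ext v
    simp only [AddMonoidHom.comp_apply, AddMonoidHom.sub_apply]
    rw [htpy_succ_of, bdry_cone_succ, map_sub, hφ, h₀]
    simp [htpy]
  | succ n ih =>
    refine DFunLike.congr_fun (f := (bdry K' (n + 2)).comp (htpy b φ (n + 2)))
      (g := φ (n + 2) - (htpy b φ (n + 1)).comp (bdry K (n + 1))) ?_ x
    ext v
    simp only [AddMonoidHom.comp_apply, AddMonoidHom.sub_apply]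
    rw [htpy_succ_of, bdry_cone_succ, map_sub, hφ, ih, bdry_bdry]
    simp

/-- The construction uses no choices beyond the apexes, so it is natural as soon as these are. This
is what lets the homotopies pass to singular simplices. -/
theorem push_htpy {L L' : Type*} {b : ∀ n, (Fin (n + 1) → K) → K'}
    {b' : ∀ n, (Fin (n + 1) → L) → L'} {φ : ∀ n, Chain K n →+ Chain K' n}
    {φ' : ∀ n, Chain L n →+ Chain L' n} {f : K → L} {f' : K' → L'}
    (hb : ∀ n (v : Fin (n + 1) → K), f' (b n v) = b' n (f ∘ v))
    (hφ : ∀ n x, push f' n (φ n x) = φ' n (push f n x)) (n : ℕ) (x : Chain K n) :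
    push f' (n + 1) (htpy b φ n x) = htpy b' φ' n (push f n x) := by
  induction n with
  | zero => simp [htpy]
  | succ n ih =>
    refine DFunLike.congr_fun (f := (push f' (n + 2)).comp (htpy b φ (n + 1)))
      (g := (htpy b' φ' (n + 1)).comp (push f (n + 1))) ?_ x
    ext v
    simp only [AddMonoidHom.comp_apply]
    rw [htpy_succ_of, push_cone, map_sub, ih, hφ, push_bdry, push_of, htpy_succ_of, hb]

end TupleChain

/-! ### Affine simplices in convex sets and evaluation of cochains on tuples -/

namespace AffineSimplex

open FreeAbelianGroup TupleChain SingCoh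

section Realization

variable {E : Type*} [AddCommGroup E] [Module ℝ E] [TopologicalSpace E] [ContinuousAdd E]
  [ContinuousSMul ℝ E] {E' : Type*} [AddCommGroup E'] [Module ℝ E'] [TopologicalSpace E']
  [ContinuousAdd E'] [ContinuousSMul ℝ E'] {E'' : Type*} [AddCommGroup E''] [Module ℝ E'']
  [TopologicalSpace E''] [ContinuousAdd E''] [ContinuousSMul ℝ E'']
  {s : Set E} {s' : Set E'} {s'' : Set E''}

/-- The affine singular simplex with the given vertices in a convex set. -/
def aff (hs : Convex ℝ s) {n : ℕ} (v : Fin (n + 1) → s) : C(stdSimplex ℝ (Fin (n + 1)), s) :=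
  ⟨fun t => ⟨∑ i, t.1 i • (v i : E),
      hs.sum_mem (fun i _ => t.2.1 i) t.2.2 (fun i _ => (v i).2)⟩,
    Continuous.subtype_mk (continuous_finsetSum _ fun i _ =>
      ((continuous_apply i).comp continuous_subtype_val).smul continuous_const) _⟩

theorem aff_coe (hs : Convex ℝ s) {n : ℕ} (v : Fin (n + 1) → s)
    (t : stdSimplex ℝ (Fin (n + 1))) : (aff hs v t : E) = ∑ i, t.1 i • (v i : E) :=
  rfl

/-- A map between convex sets is affine if it commutes with all convex combinations. -/
def IsAffine (hs : Convex ℝ s) (hs' : Convex ℝ s') (f : s → s') : Prop :=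
  ∀ (n : ℕ) (v : Fin (n + 1) → s) (t : stdSimplex ℝ (Fin (n + 1))),
    f (aff hs v t) = aff hs' (f ∘ v) t

/-- The vertices of the standard simplex. -/
def vtx (n : ℕ) (i : Fin (n + 1)) : stdSimplex ℝ (Fin (n + 1)) :=
  stdSimplex.vertex i

theorem aff_vtx (hs : Convex ℝ s) {n : ℕ} (v : Fin (n + 1) → s) (i : Fin (n + 1)) :
    aff hs v (vtx n i) = v i := by
  apply Subtype.ext
  rw [aff_coe, Finset.sum_eq_single i]
  · simp [vtx]
  · intro j _ hj
    simp [vtx, hj]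
  · simp

theorem aff_comp_vtx (hs : Convex ℝ s) {n : ℕ} (v : Fin (n + 1) → s) : aff hs v ∘ vtx n = v :=
  funext (aff_vtx hs v)

theorem isAffine_aff (hs : Convex ℝ s) {n : ℕ} (v : Fin (n + 1) → s) :
    IsAffine (convex_stdSimplex ℝ _) hs (aff hs v) := by
  intro m w t
  apply Subtype.ext
  simp only [aff_coe, Function.comp_apply, Finset.sum_apply, Pi.smul_apply, smul_eq_mul,
    Finset.smul_sum, Finset.sum_smul, mul_smul]
  exact Finset.sum_comm

theorem aff_vertices (n : ℕ) : aff (convex_stdSimplex ℝ _) (vtx n) = ContinuousMap.id _ := by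
  ext t : 1
  apply Subtype.ext
  funext k
  rw [aff_coe]
  simp [vtx, Pi.single_apply]

/-- Face inclusions are themselves affine simplices; hence restricting an affine simplex to a face
amounts to deleting a vertex, and `d` becomes dual to `bdry`. -/
theorem face_eq_aff (n : ℕ) (i : Fin (n + 2)) :
    face n i = aff (convex_stdSimplex ℝ _) (vtx (n + 1) ∘ i.succAbove) := by
  ext t : 1
  apply Subtype.ext
  funext k
  rw [aff_coe]
  change FunOnFinite.linearMap ℝ ℝ i.succAbove t k = _
  rw [FunOnFinite.linearMap_apply_apply]
  simp only [Function.comp_apply, vtx, Finset.sum_apply, Pi.smul_apply, smul_eq_mul,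
    Pi.single_apply, mul_ite, mul_one, mul_zero, Finset.sum_filter]
  refine Finset.sum_congr rfl fun j _ => ?_
  simp only [eq_comm]
  rfl

theorem aff_comp_face (hs : Convex ℝ s) {n : ℕ} (v : Fin (n + 2) → s) (i : Fin (n + 2)) :
    (aff hs v).comp (face n i) = aff hs (v ∘ i.succAbove) := by
  ext t : 1
  rw [ContinuousMap.comp_apply, face_eq_aff, isAffine_aff, ← Function.comp_assoc, aff_comp_vtx]

end Realization

section Evaluation

variable {E : Type*} [AddCommGroup E] [Module ℝ E] [TopologicalSpace E] [ContinuousAdd E]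
  [ContinuousSMul ℝ E] {E' : Type*} [AddCommGroup E'] [Module ℝ E'] [TopologicalSpace E']
  [ContinuousAdd E'] [ContinuousSMul ℝ E'] {s : Set E} {s' : Set E'}
  {X : Type u} [TopologicalSpace X] {A : Type v} [AddCommGroup A]

/-- The value of the pullback of a cochain `c` along `g : s → X` on a chain of tuples of points of
the convex set `s`. -/
def eval (hs : Convex ℝ s) (g : C(s, X)) {n : ℕ} (c : Cochain X A n) : Chain s (n + 1) →+ A :=
  lift fun v => c (g.comp (aff hs v))

@[simp] theorem eval_of (hs : Convex ℝ s) (g : C(s, X)) {n : ℕ} (c : Cochain X A n)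
    (v : Fin (n + 1) → s) : eval hs g c (of v) = c (g.comp (aff hs v)) :=
  lift_apply_of _ _

theorem eval_add (hs : Convex ℝ s) (g : C(s, X)) {n : ℕ} (c c' : Cochain X A n)
    (x : Chain s (n + 1)) : eval hs g (c + c') x = eval hs g c x + eval hs g c' x := by
  refine DFunLike.congr_fun (f := eval hs g (c + c')) (g := eval hs g c + eval hs g c') ?_ x
  ext v
  simp

theorem eval_d (hs : Convex ℝ s) (g : C(s, X)) {n : ℕ} (c : Cochain X A n)
    (x : Chain s (n + 2)) : eval hs g (d X A n c) x = eval hs g c (bdry s (n + 1) x) := by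
  refine DFunLike.congr_fun (f := eval hs g (d X A n c))
    (g := (eval hs g c).comp (bdry s (n + 1))) ?_ x
  ext v
  simp [map_sum, d, ContinuousMap.comp_assoc, aff_comp_face]

theorem eval_push (hs : Convex ℝ s) (hs' : Convex ℝ s') (g : C(s', X)) (f : C(s, s'))
    (hf : IsAffine hs hs' f) {n : ℕ} (c : Cochain X A n) (x : Chain s (n + 1)) :
    eval hs (g.comp f) c x = eval hs' g c (push f (n + 1) x) := by
  refine DFunLike.congr_fun (f := eval hs (g.comp f) c)
    (g := (eval hs' g c).comp (push f (n + 1))) ?_ x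
  ext v
  simp only [AddMonoidHom.comp_apply, push_of, eval_of, ContinuousMap.comp_assoc]
  congr 2
  ext t : 1
  exact hf n v t

/-- The fundamental chain of the standard simplex. -/
def fund (n : ℕ) : Chain (stdSimplex ℝ (Fin (n + 1))) (n + 1) :=
  of (vtx n)

theorem eval_fund {n : ℕ} (σ : C(stdSimplex ℝ (Fin (n + 1)), X)) (c : Cochain X A n) :
    eval (convex_stdSimplex ℝ _) σ c (fund n) = c σ := by
  rw [fund, eval_of, aff_vertices, ContinuousMap.comp_id]

theorem push_aff_fund (hs : Convex ℝ s) {n : ℕ} (v : Fin (n + 1) → s) :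
    push (aff hs v) (n + 1) (fund n) = of v := by
  rw [fund, push_of, aff_comp_vtx]

theorem d_d (n : ℕ) (c : Cochain X A n) : d X A (n + 1) (d X A n c) = 0 := by
  funext σ
  rw [← eval_fund σ (d X A (n + 1) (d X A n c)), eval_d, eval_d, bdry_bdry, map_zero, Pi.zero_apply]

end Evaluation

end AffineSimplex

/-! ### Barycentric subdivision and its homotopy on singular cochains -/

namespace AffineSimplex

open FreeAbelianGroup TupleChain SingCoh

section Subdivision

variable {E : Type*} [AddCommGroup E] [Module ℝ E] [TopologicalSpace E] [ContinuousAdd E]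
  [ContinuousSMul ℝ E] {E' : Type*} [AddCommGroup E'] [Module ℝ E'] [TopologicalSpace E']
  [ContinuousAdd E'] [ContinuousSMul ℝ E'] {s : Set E} {s' : Set E'}
  {X : Type u} [TopologicalSpace X] {A : Type v} [AddCommGroup A]

/-- The barycenter of a tuple of points of a convex set. -/
def bary (hs : Convex ℝ s) (n : ℕ) (v : Fin (n + 1) → s) : s :=
  aff hs v stdSimplex.barycenter

/-- Barycentric subdivision of chains of tuples. -/
def subdiv (hs : Convex ℝ s) (n : ℕ) : Chain s n →+ Chain s n :=
  sd (bary hs) n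

/-- The homotopy between the identity and barycentric subdivision. -/
def subdivHtpy (hs : Convex ℝ s) (n : ℕ) : Chain s n →+ Chain s (n + 1) :=
  htpy (bary hs) (fun n => AddMonoidHom.id _ - subdiv hs n) n

theorem push_subdiv {hs : Convex ℝ s} {hs' : Convex ℝ s'} {f : s → s'} (hf : IsAffine hs hs' f)
    (n : ℕ) (x : Chain s n) : push f n (subdiv hs n x) = subdiv hs' n (push f n x) :=
  push_sd (fun n v => hf n v _) n x

theorem push_subdivHtpy {hs : Convex ℝ s} {hs' : Convex ℝ s'} {f : s → s'}
    (hf : IsAffine hs hs' f) (n : ℕ) (x : Chain s n) :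
    push f (n + 1) (subdivHtpy hs n x) = subdivHtpy hs' n (push f n x) :=
  push_htpy (fun n v => hf n v _) (fun n x => by
    simp only [AddMonoidHom.sub_apply, AddMonoidHom.id_apply, map_sub, push_subdiv hf]) n x

theorem bdry_subdivHtpy (hs : Convex ℝ s) (n : ℕ) (x : Chain s (n + 1)) :
    bdry s (n + 1) (subdivHtpy hs (n + 1) x) =
      x - subdiv hs (n + 1) x - subdivHtpy hs n (bdry s n x) :=
  bdry_htpy (bary hs) (sub_self _) (fun n x => by
    simp only [AddMonoidHom.sub_apply, AddMonoidHom.id_apply, map_sub, subdiv, bdry_sd]) n x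

/-- Barycentric subdivision of singular cochains. -/
def coSubdiv (X : Type u) [TopologicalSpace X] (A : Type v) [AddCommGroup A] (n : ℕ) :
    Cochain X A n →+ Cochain X A n where
  toFun c := fun σ =>
    eval (convex_stdSimplex ℝ _) σ c (subdiv (convex_stdSimplex ℝ _) (n + 1) (fund n))
  map_zero' := by
    funext σ
    simpa using eval_add (convex_stdSimplex ℝ _) σ (0 : Cochain X A n) 0
      (subdiv (convex_stdSimplex ℝ _) (n + 1) (fund n))
  map_add' c c' := funext fun σ => eval_add _ σ c c' _

/-- The cochain homotopy between the identity and barycentric subdivision. -/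
def coSubdivHtpy (X : Type u) [TopologicalSpace X] (A : Type v) [AddCommGroup A] (n : ℕ) :
    Cochain X A (n + 1) →+ Cochain X A n where
  toFun c := fun σ =>
    eval (convex_stdSimplex ℝ _) σ c (subdivHtpy (convex_stdSimplex ℝ _) (n + 1) (fund n))
  map_zero' := by
    funext σ
    simpa using eval_add (convex_stdSimplex ℝ _) σ (0 : Cochain X A (n + 1)) 0
      (subdivHtpy (convex_stdSimplex ℝ _) (n + 1) (fund n))
  map_add' c c' := funext fun σ => eval_add _ σ c c' _

theorem coSubdiv_apply {n : ℕ} (c : Cochain X A n) (σ : C(stdSimplex ℝ (Fin (n + 1)), X)) :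
    coSubdiv X A n c σ =
      eval (convex_stdSimplex ℝ _) σ c (subdiv (convex_stdSimplex ℝ _) (n + 1) (fund n)) :=
  rfl

theorem coSubdivHtpy_apply {n : ℕ} (c : Cochain X A (n + 1))
    (σ : C(stdSimplex ℝ (Fin (n + 1)), X)) :
    coSubdivHtpy X A n c σ =
      eval (convex_stdSimplex ℝ _) σ c (subdivHtpy (convex_stdSimplex ℝ _) (n + 1) (fund n)) :=
  rfl

/-- Subdivision of cochains is defined through the fundamental chain alone. Any tuple is the affine
image of that chain, so naturality extends the formula to all chains and makes iteration possible.
-/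
theorem eval_coSubdiv (hs : Convex ℝ s) (g : C(s, X)) {n : ℕ} (c : Cochain X A n)
    (x : Chain s (n + 1)) :
    eval hs g (coSubdiv X A n c) x = eval hs g c (subdiv hs (n + 1) x) := by
  refine DFunLike.congr_fun (f := eval hs g (coSubdiv X A n c))
    (g := (eval hs g c).comp (subdiv hs (n + 1))) ?_ x
  ext v
  rw [eval_of, coSubdiv_apply, eval_push _ hs _ _ (isAffine_aff hs v),
    push_subdiv (isAffine_aff hs v), push_aff_fund, AddMonoidHom.comp_apply]

theorem eval_coSubdivHtpy (hs : Convex ℝ s) (g : C(s, X)) {n : ℕ} (c : Cochain X A (n + 1))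
    (x : Chain s (n + 1)) :
    eval hs g (coSubdivHtpy X A n c) x = eval hs g c (subdivHtpy hs (n + 1) x) := by
  refine DFunLike.congr_fun (f := eval hs g (coSubdivHtpy X A n c))
    (g := (eval hs g c).comp (subdivHtpy hs (n + 1))) ?_ x
  ext v
  rw [eval_of, coSubdivHtpy_apply, eval_push _ hs _ _ (isAffine_aff hs v),
    push_subdivHtpy (isAffine_aff hs v), push_aff_fund, AddMonoidHom.comp_apply]

theorem eval_coSubdiv_iterate (hs : Convex ℝ s) (g : C(s, X)) {n : ℕ} (j : ℕ) (c : Cochain X A n)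
    (x : Chain s (n + 1)) :
    eval hs g ((coSubdiv X A n)^[j] c) x = eval hs g c ((subdiv hs (n + 1))^[j] x) := by
  induction j generalizing x with
  | zero => rfl
  | succ j ih => rw [Function.iterate_succ_apply', eval_coSubdiv, ih, Function.iterate_succ_apply]

theorem d_coSubdiv {n : ℕ} (c : Cochain X A n) :
    d X A n (coSubdiv X A n c) = coSubdiv X A (n + 1) (d X A n c) := by
  funext σ
  rw [← eval_fund σ (d X A n (coSubdiv X A n c)), eval_d, eval_coSubdiv, coSubdiv_apply, eval_d]
  simp only [subdiv, bdry_sd]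

theorem d_coSubdivHtpy {n : ℕ} (c : Cochain X A (n + 1)) :
    d X A n (coSubdivHtpy X A n c) + coSubdivHtpy X A (n + 1) (d X A (n + 1) c) =
      c - coSubdiv X A (n + 1) c := by
  funext σ
  rw [Pi.add_apply, Pi.sub_apply, ← eval_fund σ (d X A n (coSubdivHtpy X A n c)), eval_d,
    eval_coSubdivHtpy, coSubdivHtpy_apply, eval_d, bdry_subdivHtpy, map_sub, map_sub, eval_fund,
    coSubdiv_apply]
  abel

end Subdivision

/-! ### The prism operator of a homotopy -/

section Prism

variable {E : Type*} [AddCommGroup E] [Module ℝ E] [TopologicalSpace E] [ContinuousAdd E]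
  [ContinuousSMul ℝ E] {E' : Type*} [AddCommGroup E'] [Module ℝ E'] [TopologicalSpace E']
  [ContinuousAdd E'] [ContinuousSMul ℝ E'] {s : Set E} {s' : Set E'}
  {X : Type u} [TopologicalSpace X] {Y : Type w} [TopologicalSpace Y] {A : Type v} [AddCommGroup A]

/-- The cylinder over a subset of a vector space. -/
abbrev Cyl (s : Set E) : Set (E × ℝ) := s ×ˢ Set.Icc (0 : ℝ) 1

theorem convex_cyl (hs : Convex ℝ s) : Convex ℝ (Cyl s) :=
  hs.prod (convex_Icc 0 1)

/-- The inclusion of `s` in the cylinder at height `t`. -/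
def level (s : Set E) (t : unitInterval) (x : s) : Cyl s :=
  ⟨(x, t), x.2, t.2⟩

/-- The map of cylinders induced by a map of the bases. -/
def cylMap (f : C(s, s')) : C(Cyl s, Cyl s') :=
  ⟨fun p => ⟨(f ⟨p.1.1, p.2.1⟩, p.1.2), (f ⟨p.1.1, p.2.1⟩).2, p.2.2⟩, by fun_prop⟩

theorem aff_cyl_fst (hs : Convex ℝ s) {n : ℕ} (v : Fin (n + 1) → Cyl s)
    (t : stdSimplex ℝ (Fin (n + 1))) :
    (aff (convex_cyl hs) v t).1.1 = aff hs (fun i => ⟨(v i).1.1, (v i).2.1⟩) t := by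
  simp [aff_coe, Prod.fst_sum]

theorem aff_cyl_snd (hs : Convex ℝ s) {n : ℕ} (v : Fin (n + 1) → Cyl s)
    (t : stdSimplex ℝ (Fin (n + 1))) :
    (aff (convex_cyl hs) v t).1.2 = ∑ i, t.1 i * (v i).1.2 := by
  simp [aff_coe, Prod.snd_sum]

theorem isAffine_level (hs : Convex ℝ s) (t : unitInterval) :
    IsAffine hs (convex_cyl hs) (level s t) := by
  intro n v p
  apply Subtype.ext
  apply Prod.ext
  · rw [aff_cyl_fst hs]
    rfl
  · rw [aff_cyl_snd hs]
    simp only [level, Function.comp_apply, ← Finset.sum_mul]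
    rw [p.2.2, one_mul]

theorem isAffine_cylMap {hs : Convex ℝ s} {hs' : Convex ℝ s'} {f : C(s, s')}
    (hf : IsAffine hs hs' f) : IsAffine (convex_cyl hs) (convex_cyl hs') (cylMap f) := by
  intro n v p
  apply Subtype.ext
  apply Prod.ext
  · rw [aff_cyl_fst hs']
    refine congrArg Subtype.val (Eq.trans ?_ (hf n (fun i => ⟨(v i).1.1, (v i).2.1⟩) p))
    congr 1
    exact Subtype.ext (aff_cyl_fst hs v p)
  · rw [aff_cyl_snd hs']
    exact aff_cyl_snd hs v p

/-- The prism operator, a chain homotopy between the inclusions of the two ends of the cylinder. -/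
def prism (s : Set E) (n : ℕ) : Chain s n →+ Chain (Cyl s) (n + 1) :=
  htpy (fun _ v => level s 0 (v 0)) (fun n => push (level s 1) n - push (level s 0) n) n

theorem bdry_prism (n : ℕ) (x : Chain s (n + 1)) :
    bdry _ (n + 1) (prism s (n + 1) x) =
      push (level s 1) (n + 1) x - push (level s 0) (n + 1) x - prism s n (bdry s n x) := by
  refine bdry_htpy _ ?_ (fun n x => ?_) n x
  · ext v
    simp only [AddMonoidHom.sub_apply, push_of, AddMonoidHom.zero_apply]
    -- In index 0 there is only the empty tuple, on which the two ends of the cylinder agree.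
    rw [Subsingleton.elim (level s 1 ∘ v) (level s 0 ∘ v), sub_self]
  · simp only [AddMonoidHom.sub_apply, map_sub, push_bdry]

theorem push_cylMap_prism (f : C(s, s')) (n : ℕ) (x : Chain s n) :
    push (cylMap f) (n + 1) (prism s n x) = prism s' n (push f n x) := by
  refine push_htpy (fun _ _ => rfl) (fun n x => ?_) n x
  simp only [AddMonoidHom.sub_apply, map_sub, push_push]
  rfl

/-- The map on cylinders obtained by composition with a homotopy. -/
def cylHtpy (F : C(X × unitInterval, Y)) (g : C(s, X)) : C(Cyl s, Y) :=
  ⟨fun p => F (g ⟨p.1.1, p.2.1⟩, ⟨p.1.2, p.2.2⟩), by fun_prop⟩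

/-- The time `t` map of a homotopy. -/
def stage (F : C(X × unitInterval, Y)) (t : unitInterval) : C(X, Y) :=
  ⟨fun x => F (x, t), by fun_prop⟩

/-- The prism operator on singular cochains. -/
def coPrism (F : C(X × unitInterval, Y)) (n : ℕ) (c : Cochain Y A (n + 1)) : Cochain X A n :=
  fun σ => eval (convex_cyl (convex_stdSimplex ℝ _)) (cylHtpy F σ) c (prism _ (n + 1) (fund n))

theorem eval_coPrism (F : C(X × unitInterval, Y)) (hs : Convex ℝ s) (g : C(s, X)) {n : ℕ}
    (c : Cochain Y A (n + 1)) (x : Chain s (n + 1)) :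
    eval hs g (coPrism F n c) x = eval (convex_cyl hs) (cylHtpy F g) c (prism s (n + 1) x) := by
  refine DFunLike.congr_fun (f := eval hs g (coPrism F n c))
    (g := (eval (convex_cyl hs) (cylHtpy F g) c).comp (prism s (n + 1))) ?_ x
  ext v
  have h : cylHtpy F (g.comp (aff hs v)) = (cylHtpy F g).comp (cylMap (aff hs v)) := rfl
  rw [eval_of, coPrism, h, eval_push _ (convex_cyl hs) _ _ (isAffine_cylMap (isAffine_aff hs v)),
    push_cylMap_prism, push_aff_fund, AddMonoidHom.comp_apply]

theorem eval_level (F : C(X × unitInterval, Y)) (hs : Convex ℝ s) (g : C(s, X)) {n : ℕ}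
    (c : Cochain Y A n) (t : unitInterval) (x : Chain s (n + 1)) :
    eval (convex_cyl hs) (cylHtpy F g) c (push (level s t) (n + 1) x) =
      eval hs g (pullback (stage F t) A n c) x := by
  let l : C(s, Cyl s) := ⟨level s t, by unfold level; fun_prop⟩
  have h := eval_push hs (convex_cyl hs) (cylHtpy F g) l (isAffine_level hs t) c x
  exact h.symm

theorem d_coPrism (F : C(X × unitInterval, Y)) {n : ℕ} (c : Cochain Y A (n + 1)) :
    d X A n (coPrism F n c) + coPrism F (n + 1) (d Y A (n + 1) c) =
      pullback (stage F 1) A (n + 1) c - pullback (stage F 0) A (n + 1) c := by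
  funext σ
  rw [Pi.add_apply, Pi.sub_apply, ← eval_fund σ (d X A n (coPrism F n c)), eval_d, eval_coPrism,
    coPrism, eval_d, bdry_prism, map_sub, map_sub,
    eval_level _ (convex_stdSimplex ℝ _), eval_level _ (convex_stdSimplex ℝ _), eval_fund, eval_fund]
  abel

end Prism

end AffineSimplex

/-! ### Mesh of iterated subdivisions -/

namespace AffineSimplex

open FreeAbelianGroup TupleChain SingCoh

section Mesh

variable {E : Type*} [NormedAddCommGroup E] [NormedSpace ℝ E] {s : Set E}

/-- The chains spanned by the tuples whose points have mutual distance at most `δ`. -/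
def fineChains (s : Set E) (n : ℕ) (δ : ℝ) : AddSubgroup (Chain s n) :=
  AddSubgroup.closure (of '' {w | ∀ i j, dist (w i) (w j) ≤ δ})

/-- The difference from `v i` is the average of n + 1 vectors `v j - v i` of norm at most δ, and the
one with j = i is zero. -/
theorem dist_bary_le (hs : Convex ℝ s) {n : ℕ} (v : Fin (n + 1) → s) {δ : ℝ}
    (h : ∀ i j, dist (v i) (v j) ≤ δ) (i : Fin (n + 1)) :
    dist (v i) (bary hs n v) ≤ n / (n + 1) * δ := by
  have hw : ∑ j : Fin (n + 1), (stdSimplex.barycenter (𝕜 := ℝ) (X := Fin (n + 1))).1 j = 1 :=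
    stdSimplex.barycenter.2.2
  have hc : ∀ j, (stdSimplex.barycenter (𝕜 := ℝ) (X := Fin (n + 1))).1 j = 1 / ((n : ℝ) + 1) := by
    intro j
    simp [stdSimplex.barycenter]
  rw [dist_comm, Subtype.dist_eq, bary, aff_coe, dist_eq_norm]
  have h₁ : ∑ j, (stdSimplex.barycenter (𝕜 := ℝ) (X := Fin (n + 1))).1 j • (v j : E) - v i =
      ∑ j, (stdSimplex.barycenter (𝕜 := ℝ) (X := Fin (n + 1))).1 j • ((v j : E) - v i) := by
    simp only [smul_sub, Finset.sum_sub_distrib, ← Finset.sum_smul, hw, one_smul]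
  rw [h₁]
  refine (norm_sum_le _ _).trans ?_
  have h₂ : ∀ j, ‖(stdSimplex.barycenter (𝕜 := ℝ) (X := Fin (n + 1))).1 j • ((v j : E) - v i)‖ ≤
      1 / ((n : ℝ) + 1) * (δ - if j = i then δ else 0) := by
    intro j
    rw [hc, norm_smul, Real.norm_of_nonneg (by positivity)]
    refine mul_le_mul_of_nonneg_left ?_ (by positivity)
    split_ifs with hj
    · simp [hj]
    · rw [sub_zero, ← dist_eq_norm]
      exact h j i
  refine (Finset.sum_le_sum fun j _ => h₂ j).trans (le_of_eq ?_)
  rw [← Finset.mul_sum, Finset.sum_sub_distrib]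
  simp
  field_simp
  ring

/-- The ratio is fixed by N so that the induction over faces does not change it. The convex hull is
carried along to bound the distance from the new apex to the older vertices: a ball about the
barycenter contains all of the hull. -/
theorem subdiv_of_mem (hs : Convex ℝ s) (N : ℕ) {δ : ℝ} (hδ : 0 ≤ δ) (n : ℕ) (hn : n ≤ N + 1)
    (v : Fin n → s) (hv : ∀ i j, dist (v i) (v j) ≤ δ) :
    subdiv hs n (of v) ∈ AddSubgroup.closure (of '' {w : Fin n → s |
      (∀ i j, dist (w i) (w j) ≤ N / (N + 1) * δ) ∧
        ∀ i, (w i : E) ∈ convexHull ℝ (Set.range fun k => (v k : E))}) := by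
  induction n with
  | zero =>
    refine AddSubgroup.subset_closure ?_
    exact ⟨v, ⟨fun i => i.elim0, fun i => i.elim0⟩, rfl⟩
  | succ n ih =>
    have hr : (n : ℝ) / (n + 1) * δ ≤ N / (N + 1) * δ := by
      refine mul_le_mul_of_nonneg_right ?_ hδ
      have : (n : ℝ) ≤ N := by exact_mod_cast Nat.le_of_succ_le_succ hn
      rw [div_le_div_iff₀ (by positivity) (by positivity)]
      linarith
    have hb : (bary hs n v : E) ∈ convexHull ℝ (Set.range fun k => (v k : E)) :=
      (convex_convexHull ℝ _).sum_mem (fun i _ => stdSimplex.barycenter.2.1 i)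
        stdSimplex.barycenter.2.2 fun i _ =>
          subset_convexHull ℝ _ (Set.mem_range_self i)
    have hball : convexHull ℝ (Set.range fun k => (v k : E)) ⊆
        Metric.closedBall (bary hs n v : E) (N / (N + 1) * δ) := by
      refine convexHull_min ?_ (convex_closedBall _ _)
      rintro _ ⟨i, rfl⟩
      exact (dist_bary_le hs v hv i).trans hr
    rw [subdiv, sd_succ_of, bdry_of, map_sum, map_sum]
    refine AddSubgroup.sum_mem _ fun i _ => ?_
    rw [map_zsmul, map_zsmul]
    refine AddSubgroup.zsmul_mem _ ?_ _
    have key := ih (by omega) (v ∘ i.succAbove) (fun j k => hv _ _)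
    rw [← AddSubgroup.mem_comap]
    refine (AddSubgroup.closure_le _).2 ?_ key
    rintro _ ⟨w, ⟨hw, hw'⟩, rfl⟩
    have hmem : ∀ j, (w j : E) ∈ convexHull ℝ (Set.range fun k => (v k : E)) := fun j =>
      convexHull_mono (by rintro _ ⟨k, rfl⟩; exact ⟨i.succAbove k, rfl⟩) (hw' j)
    refine AddSubgroup.subset_closure ⟨Fin.cons (bary hs n v) w, ⟨fun j k => ?_, fun j => ?_⟩, rfl⟩
    · refine Fin.cases ?_ (fun j => ?_) j <;> refine Fin.cases ?_ (fun k => ?_) k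
      · simpa using by positivity
      · rw [Fin.cons_zero, Fin.cons_succ, dist_comm]
        exact hball (hmem k)
      · rw [Fin.cons_zero, Fin.cons_succ]
        exact hball (hmem j)
      · rw [Fin.cons_succ, Fin.cons_succ]
        exact hw j k
    · refine Fin.cases ?_ (fun j => ?_) j
      · exact hb
      · exact hmem j

theorem subdiv_mem_fineChains (hs : Convex ℝ s) (n : ℕ) {δ : ℝ} (hδ : 0 ≤ δ)
    {x : Chain s (n + 1)} (hx : x ∈ fineChains s (n + 1) δ) :
    subdiv hs (n + 1) x ∈ fineChains s (n + 1) (n / (n + 1) * δ) := by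
  rw [← AddSubgroup.mem_comap]
  refine (AddSubgroup.closure_le _).2 ?_ hx
  rintro _ ⟨v, hv, rfl⟩
  refine AddSubgroup.closure_mono (Set.image_mono fun w hw => hw.1)
    (subdiv_of_mem hs n hδ (n + 1) le_rfl v hv)

theorem subdiv_iterate_mem_fineChains (hs : Convex ℝ s) (n : ℕ) {δ : ℝ} (hδ : 0 ≤ δ)
    {x : Chain s (n + 1)} (hx : x ∈ fineChains s (n + 1) δ) (j : ℕ) :
    (subdiv hs (n + 1))^[j] x ∈ fineChains s (n + 1) ((n / (n + 1) : ℝ) ^ j * δ) := by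
  induction j with
  | zero => simpa using hx
  | succ j ih =>
    rw [Function.iterate_succ_apply', pow_succ', mul_assoc]
    exact subdiv_mem_fineChains hs n (by positivity) ih

theorem fund_mem_fineChains (n : ℕ) : fund n ∈ fineChains _ (n + 1) 1 :=
  AddSubgroup.subset_closure ⟨vtx n, fun i j =>
    (Metric.dist_le_diam_of_mem (bounded_stdSimplex _) (vtx n i).2 (vtx n j).2).trans
      diam_stdSimplex_le, rfl⟩

theorem dist_aff_le (hs : Convex ℝ s) {n : ℕ} (v : Fin (n + 1) → s) {δ : ℝ}
    (h : ∀ i j, dist (v i) (v j) ≤ δ) (t : stdSimplex ℝ (Fin (n + 1))) :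
    dist (aff hs v t) (v 0) ≤ δ := by
  have : (aff hs v t : E) ∈ Metric.closedBall (v 0 : E) δ :=
    (convex_closedBall _ _).sum_mem (fun i _ => t.2.1 i) t.2.2 fun i _ => h i 0
  exact this

end Mesh

/-! ### Excision: acyclicity of relative cochains -/

section Excision

variable {X : Type u} [TopologicalSpace X] {A : Type v} [AddCommGroup A] {ι : Type*}

/-- The cochains that vanish on all simplices contained in one of the sets `U i`. -/
def relCochains (U : ι → Set X) (A : Type v) [AddCommGroup A] (n : ℕ) :
    AddSubgroup (Cochain X A n) where
  carrier := {c | ∀ i σ, (∀ t, σ t ∈ U i) → c σ = 0}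
  zero_mem' := fun _ _ _ => rfl
  add_mem' := fun {a b} ha hb i σ h => by rw [Pi.add_apply, ha i σ h, hb i σ h, add_zero]
  neg_mem' := fun {a} ha i σ h => by rw [Pi.neg_apply, ha i σ h, neg_zero]

theorem eval_eq_zero {E : Type*} [AddCommGroup E] [Module ℝ E] [TopologicalSpace E]
    [ContinuousAdd E] [ContinuousSMul ℝ E] {s : Set E} (hs : Convex ℝ s) {U : ι → Set X} {n : ℕ}
    {c : Cochain X A n} (hc : c ∈ relCochains U A n) {g : C(s, X)} {i : ι} (hg : ∀ p, g p ∈ U i)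
    (x : Chain s (n + 1)) : eval hs g c x = 0 := by
  refine DFunLike.congr_fun (f := eval hs g c) (g := 0) ?_ x
  ext v
  rw [eval_of]
  exact hc i _ fun t => hg _

theorem coSubdiv_mem {U : ι → Set X} {n : ℕ} {c : Cochain X A n} (hc : c ∈ relCochains U A n) :
    coSubdiv X A n c ∈ relCochains U A n :=
  fun _ _ h => eval_eq_zero _ hc h _

theorem coSubdivHtpy_mem {U : ι → Set X} {n : ℕ} {c : Cochain X A (n + 1)}
    (hc : c ∈ relCochains U A (n + 1)) : coSubdivHtpy X A n c ∈ relCochains U A n :=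
  fun _ _ h => eval_eq_zero _ hc h _

theorem coSubdiv_iterate_mem {U : ι → Set X} {n : ℕ} {c : Cochain X A n}
    (hc : c ∈ relCochains U A n) (j : ℕ) : (coSubdiv X A n)^[j] c ∈ relCochains U A n := by
  induction j with
  | zero => exact hc
  | succ j ih =>
    rw [Function.iterate_succ_apply']
    exact coSubdiv_mem ih

/-- On a given simplex, iterated subdivision annihilates all relative cochains eventually. -/
theorem exists_coSubdiv_iterate_eq_zero {U : ι → Set X} (hU : ∀ i, IsOpen (U i))
    (hcov : ∀ x, ∃ i, x ∈ U i) {n : ℕ} (σ : C(stdSimplex ℝ (Fin (n + 1)), X)) :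
    ∃ m, ∀ j, m ≤ j → ∀ c ∈ relCochains U A n, (coSubdiv X A n)^[j] c σ = 0 := by
  -- ε is a Lebesgue number of the cover pulled back to the simplex; m is chosen so that the mesh of
  -- the m-fold subdivision is below it.
  obtain ⟨ε, hε, hball⟩ := lebesgue_number_lemma_of_metric
    (isCompact_univ (X := stdSimplex ℝ (Fin (n + 1)))) (c := fun i => σ ⁻¹' U i)
    (fun i => (hU i).preimage σ.continuous) (fun x _ => Set.mem_iUnion.2 (hcov (σ x)))
  have hr0 : (0 : ℝ) ≤ n / (n + 1) := by positivity
  have hr1 : (n : ℝ) / (n + 1) < 1 := by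
    rw [div_lt_one (by positivity)]
    linarith
  obtain ⟨m, hm⟩ := exists_pow_lt_of_lt_one hε hr1
  refine ⟨m, fun j hj c hc => ?_⟩
  have hlt : ((n : ℝ) / (n + 1)) ^ j * 1 < ε := by
    rw [mul_one]
    exact (pow_le_pow_of_le_one hr0 hr1.le hj).trans_lt hm
  have hmem := subdiv_iterate_mem_fineChains (convex_stdSimplex ℝ (Fin (n + 1))) n zero_le_one
    (fund_mem_fineChains n) j
  rw [← eval_fund σ ((coSubdiv X A n)^[j] c), eval_coSubdiv_iterate]
  refine (AddSubgroup.closure_le (AddMonoidHom.ker _)).2 ?_ hmem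
  rintro _ ⟨v, hv, rfl⟩
  obtain ⟨i, hi⟩ := hball (v 0) (Set.mem_univ _)
  refine (eval_of _ _ _ _).trans (hc i _ fun t => ?_)
  exact hi ((dist_aff_le _ v hv t).trans_lt hlt)

/-- The cochain homotopy between the identity and the `m`-fold subdivision. -/
def iterHtpy (X : Type u) [TopologicalSpace X] (A : Type v) [AddCommGroup A] (n m : ℕ)
    (c : Cochain X A (n + 1)) : Cochain X A n :=
  ∑ j ∈ Finset.range m, (coSubdiv X A n)^[j] (coSubdivHtpy X A n c)

theorem d_coSubdiv_iterate {n : ℕ} (j : ℕ) (c : Cochain X A n) :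
    d X A n ((coSubdiv X A n)^[j] c) = (coSubdiv X A (n + 1))^[j] (d X A n c) := by
  induction j generalizing c with
  | zero => rfl
  | succ j ih => rw [Function.iterate_succ_apply, ih, d_coSubdiv, Function.iterate_succ_apply]

/-- On a cocycle the one-step homotopy gives `z - Sd z`; applying powers of subdivision and summing
telescopes. -/
theorem d_iterHtpy {n : ℕ} (m : ℕ) {z : Cochain X A (n + 1)} (hz : d X A (n + 1) z = 0) :
    d X A n (iterHtpy X A n m z) = z - (coSubdiv X A (n + 1))^[m] z := by
  have h := d_coSubdivHtpy z
  rw [hz, map_zero, add_zero] at h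
  induction m with
  | zero => simp [iterHtpy]
  | succ m ih =>
    rw [iterHtpy, Finset.sum_range_succ, map_add, ← iterHtpy, ih, d_coSubdiv_iterate, h,
      iterate_map_sub, Function.iterate_succ_apply]
    abel

theorem iterHtpy_mem {U : ι → Set X} {n : ℕ} (m : ℕ) {c : Cochain X A (n + 1)}
    (hc : c ∈ relCochains U A (n + 1)) : iterHtpy X A n m c ∈ relCochains U A n :=
  AddSubgroup.sum_mem _ fun j _ => coSubdiv_iterate_mem (coSubdivHtpy_mem hc) j

/-- Excision: the cochains relative to an open cover form an acyclic complex. -/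
theorem exists_d_eq_of_isOpen {U : ι → Set X} (hU : ∀ i, IsOpen (U i))
    (hcov : ∀ x, ∃ i, x ∈ U i) {n : ℕ} {z : Cochain X A (n + 1)}
    (hz : z ∈ relCochains U A (n + 1)) (hdz : d X A (n + 1) z = 0) :
    ∃ k ∈ relCochains U A n, d X A n k = z := by
  choose m hm using fun σ : C(stdSimplex ℝ (Fin (n + 1)), X) =>
    exists_coSubdiv_iterate_eq_zero (A := A) hU hcov σ
  -- No single number of subdivisions serves all simplices, but on a given σ all summands from index
  -- `m σ` on vanish. The infinite sum of homotopies is therefore finite at each simplex, and this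
  -- sum is the required primitive.
  have hstable : ∀ σ M, m σ ≤ M → iterHtpy X A n M z σ = iterHtpy X A n (m σ) z σ := by
    intro σ M hM
    induction M, hM using Nat.le_induction with
    | base => rfl
    | succ M hM ih =>
      rw [← ih, iterHtpy, Finset.sum_range_succ, Pi.add_apply,
        hm σ M hM _ (coSubdivHtpy_mem hz), add_zero, iterHtpy]
  refine ⟨fun σ => iterHtpy X A n (m σ) z σ, fun i σ h => iterHtpy_mem _ hz i σ h, ?_⟩
  funext σ
  obtain ⟨m', hm'⟩ := exists_coSubdiv_iterate_eq_zero (A := A) hU hcov σ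
  -- One M large enough for σ and all its faces reduces the coboundary at σ to the identity for the
  -- finite homotopy.
  let M := m' + ∑ i : Fin (n + 2), m (σ.comp (face n i))
  have h₁ : ∀ i : Fin (n + 2), m (σ.comp (face n i)) ≤ M := fun i =>
    (Finset.single_le_sum (f := fun i => m (σ.comp (face n i))) (fun _ _ => Nat.zero_le _)
      (Finset.mem_univ i)).trans (Nat.le_add_left _ _)
  have h₂ := congrFun (d_iterHtpy M hdz) σ
  rw [Pi.sub_apply, hm' M (Nat.le_add_right _ _) z hz, sub_zero] at h₂
  rw [← h₂]
  have hd : ∀ c : Cochain X A n, d X A n c σ =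
      ∑ i : Fin (n + 2), ((-1 : ℤ) ^ (i : ℕ)) • c (σ.comp (face n i)) := fun _ => rfl
  rw [hd, hd]
  exact Finset.sum_congr rfl fun i _ => by rw [hstable _ M (h₁ i)]

/-- Relative cochains for a family of sets that is a deformation of an open cover form an acyclic
complex. -/
theorem exists_d_eq_of_deformation {U Z : ι → Set X} (hU : ∀ i, IsOpen (U i))
    (hcov : ∀ x, ∃ i, x ∈ U i) (hZU : ∀ i, Z i ⊆ U i) (F : C(X × unitInterval, X))
    (hF₀ : ∀ x, F (x, 0) = x) (hFZ : ∀ i, ∀ x ∈ Z i, ∀ t, F (x, t) ∈ Z i)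
    (hF₁ : ∀ i, ∀ x ∈ U i, F (x, 1) ∈ Z i) {n : ℕ} {z : Cochain X A (n + 1)}
    (hz : z ∈ relCochains Z A (n + 1)) (hdz : d X A (n + 1) z = 0) :
    ∃ k ∈ relCochains Z A n, d X A n k = z := by
  have hp : pullback (stage F 1) A (n + 1) z ∈ relCochains U A (n + 1) := fun i σ h =>
    hz i _ fun t => hF₁ i _ (h t)
  have hdp : d X A (n + 1) (pullback (stage F 1) A (n + 1) z) = 0 := by
    rw [d_pullback, hdz, map_zero]
  obtain ⟨k, hk, hdk⟩ := exists_d_eq_of_isOpen hU hcov hp hdp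
  have h := d_coPrism F z
  have h0 : pullback (stage F 0) A (n + 1) z = z := by
    funext σ
    change z _ = z _
    congr 1
    ext t
    exact hF₀ _
  have hP : coPrism F (n + 1) (0 : Cochain X A (n + 2)) = 0 := by
    funext σ
    -- The zero cochain is relative to the whole space, so every evaluation of it vanishes.
    exact eval_eq_zero (U := fun _ : Unit => Set.univ) (i := ()) _ (fun _ _ _ => rfl)
      (fun _ => trivial) _
  rw [hdz, hP, add_zero, h0] at h
  -- `k` is a primitive of the time-one pullback of `z`, and the prism term accounts for its
  -- difference from `z`. The prism stays relative to `Z` because the homotopy preserves each `Z i`.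
  refine ⟨k - coPrism F n z, ?_, ?_⟩
  · refine AddSubgroup.sub_mem _ (fun i σ hσ => hk i σ fun t => hZU i (hσ t)) fun i σ hσ => ?_
    exact eval_eq_zero _ hz (fun p => hFZ i _ (hσ _) _) _
  · rw [map_sub, hdk, h, sub_sub_cancel]

end Excision

end AffineSimplex

/-! ### The Mayer–Vietoris boundary from acyclic relative cochains -/

namespace SingCoh

section MayerVietoris

/-- Composition with an injective map is injective on simplices, so a cochain extends by zero. -/
theorem exists_pullback_eq {L Z : Type*} [TopologicalSpace L] [TopologicalSpace Z] {A : Type*}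
    [AddCommGroup A] {ι : C(L, Z)} (hι : Function.Injective ι) {n : ℕ} (c : Cochain L A n) :
    ∃ e : Cochain Z A n, pullback ι A n e = c := by
  have hinj : Function.Injective fun σ : C(stdSimplex ℝ (Fin (n + 1)), L) => ι.comp σ :=
    fun σ τ h => ContinuousMap.ext fun t => hι (DFunLike.congr_fun h t)
  exact ⟨Function.extend (fun σ => ι.comp σ) c 0, funext fun σ => hinj.extend_apply c 0 σ⟩

theorem cls_eq_zero_iff {X : Type*} [TopologicalSpace X] {A : Type*} [AddCommGroup A] {n : ℕ}
    (z : cocycles X A (n + 1)) :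
    cls z = 0 ↔ ∃ e : Cochain X A n, d X A n e = (z : Cochain X A (n + 1)) :=
  QuotientAddGroup.eq_zero_iff z

theorem cls_surjective {X : Type*} [TopologicalSpace X] {A : Type*} [AddCommGroup A] {n : ℕ}
    (x : H X A n) : ∃ z : cocycles X A n, cls z = x :=
  QuotientAddGroup.mk'_surjective _ x

variable {L Z₁ Z₂ Y : Type*} [TopologicalSpace L] [TopologicalSpace Z₁] [TopologicalSpace Z₂]
  [TopologicalSpace Y] {A : Type*} [AddCommGroup A] {ι₁ : C(L, Z₁)} {ι₂ : C(L, Z₂)}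
  {i₁ : C(Z₁, Y)} {i₂ : C(Z₂, Y)}

/-- A simplex lying in both pieces comes from `L` by `hlift`, where the two values agree; simplices
in neither piece get the value zero. -/
theorem exists_glue (hi₁ : Function.Injective i₁) (hi₂ : Function.Injective i₂) {n : ℕ}
    (hlift : ∀ (σ₁ : C(stdSimplex ℝ (Fin (n + 1)), Z₁)) (σ₂ : C(stdSimplex ℝ (Fin (n + 1)), Z₂)),
      i₁.comp σ₁ = i₂.comp σ₂ → ∃ τ, ι₁.comp τ = σ₁ ∧ ι₂.comp τ = σ₂)
    {β₁ : Cochain Z₁ A n} {β₂ : Cochain Z₂ A n}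
    (h : pullback ι₁ A n β₁ = pullback ι₂ A n β₂) :
    ∃ β : Cochain Y A n, pullback i₁ A n β = β₁ ∧ pullback i₂ A n β = β₂ := by
  have hinj₁ : Function.Injective fun σ : C(stdSimplex ℝ (Fin (n + 1)), Z₁) => i₁.comp σ :=
    fun σ τ h => ContinuousMap.ext fun t => hi₁ (DFunLike.congr_fun h t)
  have hinj₂ : Function.Injective fun σ : C(stdSimplex ℝ (Fin (n + 1)), Z₂) => i₂.comp σ :=
    fun σ τ h => ContinuousMap.ext fun t => hi₂ (DFunLike.congr_fun h t)
  refine ⟨Function.extend (fun σ => i₁.comp σ) β₁ (Function.extend (fun σ => i₂.comp σ) β₂ 0),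
    funext fun σ => hinj₁.extend_apply _ _ σ, funext fun σ₂ => ?_⟩
  change Function.extend _ _ _ (i₂.comp σ₂) = _
  by_cases hσ : ∃ σ₁, i₁.comp σ₁ = i₂.comp σ₂
  · obtain ⟨σ₁, hσ₁⟩ := hσ
    obtain ⟨τ, rfl, rfl⟩ := hlift σ₁ σ₂ hσ₁
    rw [← hσ₁, hinj₁.extend_apply]
    exact congrFun h τ
  · rw [Function.extend_apply' _ _ _ hσ, hinj₂.extend_apply]

/-- The Mayer–Vietoris boundary homomorphism exists when the intersection is correctly identified
on the level of simplices and the cochains relative to the two pieces form an acyclic complex. -/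
theorem exists_isMayerVietorisBoundary (hι₁ : Function.Injective ι₁)
    (hi₁ : Function.Injective i₁) (hi₂ : Function.Injective i₂)
    (hlift : ∀ (n : ℕ) (σ₁ : C(stdSimplex ℝ (Fin (n + 1)), Z₁))
      (σ₂ : C(stdSimplex ℝ (Fin (n + 1)), Z₂)),
      i₁.comp σ₁ = i₂.comp σ₂ → ∃ τ, ι₁.comp τ = σ₁ ∧ ι₂.comp τ = σ₂)
    (hrel : ∀ (n : ℕ) (z : Cochain Y A (n + 1)), pullback i₁ A (n + 1) z = 0 →
      pullback i₂ A (n + 1) z = 0 → d Y A (n + 1) z = 0 →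
      ∃ k : Cochain Y A n, pullback i₁ A n k = 0 ∧ pullback i₂ A n k = 0 ∧ d Y A n k = z)
    (n : ℕ) :
    ∃ δ : H L A (n + 1) →+ H Y A (n + 2), IsMayerVietorisBoundary ι₁ ι₂ i₁ i₂ (n + 1) δ := by
  let R (x : H L A (n + 1)) (y : H Y A (n + 2)) : Prop :=
    ∃ (a : cocycles L A (n + 1)) (z : cocycles Y A (n + 2))
      (β₁ : Cochain Z₁ A (n + 1)) (β₂ : Cochain Z₂ A (n + 1)),
      cls a = x ∧ cls z = y ∧
      pullback ι₁ A (n + 1) β₁ - pullback ι₂ A (n + 1) β₂ = (a : Cochain L A (n + 1)) ∧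
      d Z₁ A (n + 1) β₁ = pullback i₁ A (n + 2) (z : Cochain Y A (n + 2)) ∧
      d Z₂ A (n + 1) β₂ = pullback i₂ A (n + 2) (z : Cochain Y A (n + 2))
  have hadd : ∀ {x x' y y'}, R x y → R x' y' → R (x + x') (y + y') := by
    rintro _ _ _ _ ⟨a, z, β₁, β₂, rfl, rfl, h, h₁, h₂⟩ ⟨a', z', β₁', β₂', rfl, rfl, h', h₁', h₂'⟩
    refine ⟨a + a', z + z', β₁ + β₁', β₂ + β₂', map_add _ _ _, map_add _ _ _, ?_, ?_, ?_⟩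
    · rw [map_add, map_add, AddSubgroup.coe_add, ← h, ← h']
      abel
    · rw [map_add, h₁, h₁', AddSubgroup.coe_add, map_add]
    · rw [map_add, h₂, h₂', AddSubgroup.coe_add, map_add]
  have hneg : ∀ {x y}, R x y → R (-x) (-y) := by
    rintro _ _ ⟨a, z, β₁, β₂, rfl, rfl, h, h₁, h₂⟩
    refine ⟨-a, -z, -β₁, -β₂, map_neg _ _, map_neg _ _, ?_, ?_, ?_⟩
    · rw [map_neg, map_neg, AddSubgroup.coe_neg, ← h]
      abel
    · rw [map_neg, h₁, AddSubgroup.coe_neg, map_neg]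
    · rw [map_neg, h₂, AddSubgroup.coe_neg, map_neg]
  have hzero : ∀ {y}, R 0 y → y = 0 := by
    rintro _ ⟨a, z, β₁, β₂, ha, rfl, h, h₁, h₂⟩
    obtain ⟨e, he⟩ := (cls_eq_zero_iff a).1 ha
    obtain ⟨e₁, rfl⟩ := exists_pullback_eq (A := A) hι₁ e
    -- If `a` is the coboundary of `ι₁^* e₁`, correcting `β₁` by `d e₁` makes the two cochains agree
    -- on `L`. They glue to β, and `z - dβ` is a relative cocycle, hence exact.
    obtain ⟨β, hβ₁, hβ₂⟩ := exists_glue hi₁ hi₂ (hlift (n + 1)) (β₁ := β₁ - d Z₁ A n e₁)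
      (β₂ := β₂) (by
        rw [map_sub, ← d_pullback, he, ← h, sub_sub_cancel])
    obtain ⟨k, -, -, hk⟩ := hrel (n + 1) (z - d Y A (n + 1) β)
      (by rw [map_sub, ← d_pullback, hβ₁, map_sub, AffineSimplex.d_d, h₁, sub_zero, sub_self])
      (by rw [map_sub, ← d_pullback, hβ₂, h₂, sub_self])
      (by rw [map_sub, AffineSimplex.d_d, sub_zero]; exact z.2)
    exact (cls_eq_zero_iff z).2 ⟨k + β, by rw [map_add, hk, sub_add_cancel]⟩
  have htot : ∀ x, ∃ y, R x y := by
    intro x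
    obtain ⟨a, rfl⟩ := cls_surjective x
    have hda : d L A (n + 1) a = 0 := a.2
    obtain ⟨β₁, hβ₁⟩ := exists_pullback_eq (A := A) hι₁ (a : Cochain L A (n + 1))
    -- With `β₂ = 0` the coboundaries glue to a cochain `w`. It need not be closed on simplices that
    -- lie in neither piece, but `dw` is a relative cocycle, and subtracting a relative primitive
    -- repairs this.
    obtain ⟨w, hw₁, hw₂⟩ := exists_glue hi₁ hi₂ (hlift (n + 2)) (β₁ := d Z₁ A (n + 1) β₁)
      (β₂ := 0) (by rw [← d_pullback, hβ₁, hda, map_zero])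
    obtain ⟨k, hk₁, hk₂, hk⟩ := hrel (n + 2) (d Y A (n + 2) w)
      (by rw [← d_pullback, hw₁, AffineSimplex.d_d]) (by rw [← d_pullback, hw₂, map_zero])
      (AffineSimplex.d_d _ _)
    have hz : w - k ∈ cocycles Y A (n + 2) := by
      change d Y A (n + 2) (w - k) = 0
      rw [map_sub, hk, sub_self]
    refine ⟨cls ⟨w - k, hz⟩, a, ⟨w - k, hz⟩, β₁, 0, rfl, rfl, ?_, ?_, ?_⟩
    · rw [map_zero, sub_zero, hβ₁]
    · rw [map_sub, hw₁, hk₁, sub_zero]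
    · rw [map_sub, hw₂, hk₂, sub_zero, map_zero]
  have huniq : ∀ {x y y'}, R x y → R x y' → y = y' := fun {x y y'} h h' => by
    have h₀ := hadd h (hneg h')
    rw [add_neg_cancel] at h₀
    exact add_neg_eq_zero.1 (hzero h₀)
  -- The relation is additive and single-valued, so any function chosen from it is a homomorphism.
  choose f hf using htot
  refine ⟨AddMonoidHom.mk' f fun x x' => huniq (hf _) (hadd (hf x) (hf x')), fun x y => ⟨?_, ?_⟩⟩
  · rintro rfl
    exact hf x
  · exact fun h => huniq (hf x) h

end MayerVietoris

end SingCoh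

/-! ### Topology of the double mapping cylinder -/

namespace FiberwiseJoin

open SingCoh

variable (X : Type u) [TopologicalSpace X]

theorem _root_.Topology.IsQuotientMap.restrictPreimage_isClosed {S T : Type*} [TopologicalSpace S]
    [TopologicalSpace T] {f : S → T} (hf : Topology.IsQuotientMap f) {s : Set T}
    (hs : IsClosed s) : Topology.IsQuotientMap (s.restrictPreimage f) := by
  refine Topology.isQuotientMap_iff_isClosed.2 ⟨hf.surjective.restrictPreimage _, fun C => ?_⟩
  rw [hs.isClosedEmbedding_subtypeVal.isClosed_iff_image_isClosed, ← hf.isClosed_preimage,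
    (hs.preimage hf.continuous).isClosedEmbedding_subtypeVal.isClosed_iff_image_isClosed,
    Set.image_val_preimage_restrictPreimage]

theorem isQuotientMap_toP₂ : Topology.IsQuotientMap (toP₂ X) :=
  isQuotientMap_quot_mk

variable {X}

/-- A continuous map on the disjoint union descends to a closed subset of the double mapping
cylinder if it respects the gluing relation there. -/
theorem exists_lift {W : Type*} [TopologicalSpace W] {S : Set (P₂ X)} (hS : IsClosed S)
    (g : C(PreJoin X, W)) (h : ∀ a b, Glue X a b → toP₂ X a ∈ S → g a = g b) :
    ∃ f : C(S, W), ∀ a (ha : toP₂ X a ∈ S), f ⟨toP₂ X a, ha⟩ = g a := by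
  classical
  -- φ only serves to show that `g` is constant on the fibers over `S`, with `none` as the value
  -- elsewhere; continuity comes from the restricted quotient map.
  let φ : P₂ X → Option W := Quot.lift (fun a => if toP₂ X a ∈ S then some (g a) else none) (by
    intro a b hab
    have he : toP₂ X a = toP₂ X b := Quot.sound hab
    by_cases ha : toP₂ X a ∈ S
    · rw [if_pos ha, if_pos (he ▸ ha), h a b hab ha]
    · rw [if_neg ha, if_neg (he ▸ ha)])
  have hφ : ∀ a, toP₂ X a ∈ S → φ (toP₂ X a) = some (g a) := fun a ha => if_pos ha
  have hq := (isQuotientMap_toP₂ X).restrictPreimage_isClosed hS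
  let p : C(toP₂ X ⁻¹' S, S) := ⟨S.restrictPreimage (toP₂ X), hq.continuous⟩
  have hp : Topology.IsQuotientMap p := hq
  let g' : C(toP₂ X ⁻¹' S, W) := ⟨fun a => g a.1, by fun_prop⟩
  have hg' : Function.FactorsThrough g' p := by
    intro a b hab
    have hab' : toP₂ X a.1 = toP₂ X b.1 := congrArg Subtype.val hab
    have := hφ a.1 a.2
    rw [hab', hφ b.1 b.2] at this
    exact (Option.some_injective _ this).symm
  refine ⟨hp.lift g' hg', fun a ha => ?_⟩
  exact DFunLike.congr_fun (hp.lift_comp g' hg') ⟨a, ha⟩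

theorem one_le_q (y : P₂ X) : 1 ≤ q X y := by
  obtain ⟨(⟨γ, t⟩ | γ | γ), rfl⟩ := (isQuotientMap_toP₂ X).surjective y
  · exact t.2.1
  · exact le_rfl
  · exact one_le_two

theorem q_le_two (y : P₂ X) : q X y ≤ 2 := by
  obtain ⟨(⟨γ, t⟩ | γ | γ), rfl⟩ := (isQuotientMap_toP₂ X).surjective y
  · exact t.2.2
  · exact one_le_two
  · exact le_rfl

theorem isClosed_Z₁ : IsClosed (Z₁ X) := isClosed_Icc.preimage (q X).continuous

theorem isClosed_Z₂ : IsClosed (Z₂ X) := isClosed_Icc.preimage (q X).continuous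

theorem endpoints_r₁ (γ : LoopSpace X) :
    endpoints X (r₁ X γ) = (γ.1 0, γ.1 ⟨1 / 2, by norm_num, by norm_num⟩) := by
  refine Prod.ext (congrArg γ.1 (Subtype.ext ?_)) (congrArg γ.1 (Subtype.ext ?_)) <;> simp [psi₁]

theorem endpoints_r₂ (γ : LoopSpace X) :
    endpoints X (r₂ X γ) = (γ.1 0, γ.1 ⟨1 / 2, by norm_num, by norm_num⟩) := by
  refine Prod.ext (Eq.trans (congrArg γ.1 (Subtype.ext ?_)) γ.2.symm)
    (congrArg γ.1 (Subtype.ext ?_))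
  · simp [psi₂]
  · norm_num [psi₂]

/-- The mapping cylinder of `r₁` retracts to the path space. -/
theorem exists_retraction₁ : ∃ ρ : C(Z₁ X, PathSpace X),
    ρ.comp (ι₁ X) = r₁ X ∧ (endpoints X).comp ρ = (π₂ X).comp (i₁ X) := by
  obtain ⟨ρ, hρ⟩ := exists_lift (isClosed_Z₁ (X := X))
    ⟨Sum.elim (fun p => r₁ X p.1) (Sum.elim id id), by
      refine Continuous.sumElim ?_ (Continuous.sumElim ?_ ?_) <;> fun_prop⟩ (by
      rintro _ _ (γ | γ) h
      · rfl
      · have h' : (2 : ℝ) ≤ 3 / 2 := h.2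
        norm_num at h')
  refine ⟨ρ, ContinuousMap.ext fun γ => hρ _ _, ContinuousMap.ext ?_⟩
  rintro ⟨y, hy⟩
  obtain ⟨a, rfl⟩ := (isQuotientMap_toP₂ X).surjective y
  rw [ContinuousMap.comp_apply, hρ]
  obtain (⟨γ, t⟩ | γ | γ) := a
  · exact endpoints_r₁ γ
  · rfl
  · rfl

/-- The mapping cylinder of `r₂` retracts to the path space. -/
theorem exists_retraction₂ : ∃ ρ : C(Z₂ X, PathSpace X),
    ρ.comp (ι₂ X) = r₂ X ∧ (endpoints X).comp ρ = (π₂ X).comp (i₂ X) := by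
  obtain ⟨ρ, hρ⟩ := exists_lift (isClosed_Z₂ (X := X))
    ⟨Sum.elim (fun p => r₂ X p.1) (Sum.elim id id), by
      refine Continuous.sumElim ?_ (Continuous.sumElim ?_ ?_) <;> fun_prop⟩ (by
      rintro _ _ (γ | γ) h
      · have h' : (3 / 2 : ℝ) ≤ 1 := h.1
        norm_num at h'
      · rfl)
  refine ⟨ρ, ContinuousMap.ext fun γ => hρ _ _, ContinuousMap.ext ?_⟩
  rintro ⟨y, hy⟩
  obtain ⟨a, rfl⟩ := (isQuotientMap_toP₂ X).surjective y
  rw [ContinuousMap.comp_apply, hρ]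
  obtain (⟨γ, t⟩ | γ | γ) := a
  · exact endpoints_r₂ γ
  · rfl
  · rfl

/-- The map `mid` identifies the free loop space with the intersection of the two mapping
cylinders. -/
theorem exists_mid_inverse : ∃ g : C((Z₁ X ∩ Z₂ X : Set (P₂ X)), LoopSpace X),
    (∀ y, mid X (g y) = y) ∧ ∀ γ h, g ⟨mid X γ, h⟩ = γ := by
  -- The target is the path space because the map must be defined on the two copies of it as well,
  -- whose points are not loops. Neither copy meets the intersection, so the values there are loops
  -- after all.
  obtain ⟨f, hf⟩ := exists_lift ((isClosed_Z₁ (X := X)).inter isClosed_Z₂)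
    (⟨Sum.elim (fun p => p.1.1) (Sum.elim id id), by
      refine Continuous.sumElim ?_ (Continuous.sumElim ?_ ?_) <;> fun_prop⟩ :
      C(PreJoin X, PathSpace X)) (by
      rintro _ _ (γ | γ) h
      · have h' : (3 / 2 : ℝ) ≤ 1 := h.2.1
        norm_num at h'
      · have h' : (2 : ℝ) ≤ 3 / 2 := h.1.2
        norm_num at h')
  have key : ∀ y : (Z₁ X ∩ Z₂ X : Set (P₂ X)), ∃ γ : LoopSpace X, mid X γ = y ∧ f y = γ.1 := by
    rintro ⟨y, hy⟩
    obtain ⟨a, rfl⟩ := (isQuotientMap_toP₂ X).surjective y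
    rw [hf]
    obtain (⟨γ, t⟩ | γ | γ) := a
    · have ht : t = ⟨3 / 2, by norm_num, by norm_num⟩ :=
        Subtype.ext (le_antisymm hy.1.2 hy.2.1)
      subst ht
      exact ⟨γ, rfl, rfl⟩
    · have h' : (3 / 2 : ℝ) ≤ 1 := hy.2.1
      norm_num at h'
    · have h' : (2 : ℝ) ≤ 3 / 2 := hy.1.2
      norm_num at h'
  have hloop : ∀ y, f y 0 = f y 1 := fun y => by
    obtain ⟨γ, -, hγ⟩ := key y
    rw [hγ]
    exact γ.2
  refine ⟨⟨fun y => ⟨f y, hloop y⟩, f.continuous.subtype_mk hloop⟩, fun y => ?_,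
    fun γ h => Subtype.ext (hf _ h)⟩
  obtain ⟨γ, hγ, hγ'⟩ := key y
  rw [← hγ]
  exact congrArg _ (Subtype.ext hγ')

theorem mid_mem (γ : LoopSpace X) : mid X γ ∈ Z₁ X ∩ Z₂ X :=
  ⟨(ι₁ X γ).2, (ι₂ X γ).2⟩

theorem ι₁_injective : Function.Injective (ι₁ X) := by
  obtain ⟨g, -, hg⟩ := exists_mid_inverse (X := X)
  intro γ γ' h
  have h' : mid X γ = mid X γ' := congrArg Subtype.val h
  rw [← hg γ (mid_mem γ), ← hg γ' (mid_mem γ')]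
  congr 1
  exact Subtype.ext h'

/-- The common map lands in the intersection, where the inverse of `mid` is continuous. -/
theorem exists_lift_simplex {Δ : Type*} [TopologicalSpace Δ] (σ₁ : C(Δ, Z₁ X)) (σ₂ : C(Δ, Z₂ X))
    (h : (i₁ X).comp σ₁ = (i₂ X).comp σ₂) :
    ∃ τ : C(Δ, LoopSpace X), (ι₁ X).comp τ = σ₁ ∧ (ι₂ X).comp τ = σ₂ := by
  obtain ⟨g, hg, -⟩ := exists_mid_inverse (X := X)
  have h' : ∀ t, (σ₁ t : P₂ X) = σ₂ t := fun t => DFunLike.congr_fun h t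
  let σ : C(Δ, (Z₁ X ∩ Z₂ X : Set (P₂ X))) :=
    ⟨fun t => ⟨σ₁ t, (σ₁ t).2, h' t ▸ (σ₂ t).2⟩, by fun_prop⟩
  refine ⟨g.comp σ, ContinuousMap.ext fun t => Subtype.ext (hg (σ t)),
    ContinuousMap.ext fun t => Subtype.ext ((hg (σ t)).trans (h' t))⟩

/-- The piecewise linear function on `[1, 2]` that fixes the end points and takes the value `3/2`
on `[5/4, 7/4]`. -/
def flat (t : ℝ) : ℝ := max (min (2 * t - 1) (3 / 2)) (2 * t - 2)

theorem flat_mem {t : ℝ} (ht : t ∈ Set.Icc (1 : ℝ) 2) : flat t ∈ Set.Icc (1 : ℝ) 2 := by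
  refine ⟨le_max_of_le_left (le_min ?_ ?_), max_le (min_le_of_right_le ?_) ?_⟩ <;>
    linarith [ht.1, ht.2]

theorem flat_le {t : ℝ} (ht : t ≤ 7 / 4) : flat t ≤ 3 / 2 :=
  max_le (min_le_right _ _) (by linarith)

theorem le_flat {t : ℝ} (ht : 5 / 4 ≤ t) : 3 / 2 ≤ flat t :=
  le_max_of_le_left (le_min (by linarith) le_rfl)

/-- The linear homotopy from the identity to `flat`. -/
def stretch : C(Set.Icc (1 : ℝ) 2 × unitInterval, Set.Icc (1 : ℝ) 2) :=
  ⟨fun p => ⟨(1 - (p.2 : ℝ)) * p.1 + p.2 * flat p.1,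
    convex_Icc (1 : ℝ) 2 p.1.2 (flat_mem p.1.2) (sub_nonneg.2 p.2.2.2) p.2.2.1
      (sub_add_cancel _ _)⟩, by unfold flat; fun_prop⟩

/-- The homotopy of the double mapping cylinder induced by `stretch`. -/
theorem exists_flow : ∃ F : C(P₂ X × unitInterval, P₂ X), (∀ y, F (y, 0) = y) ∧
    ∀ y s, q X (F (y, s)) = (1 - (s : ℝ)) * q X y + s * flat (q X y) := by
  let G₀ : C((LoopSpace X × Set.Icc (1 : ℝ) 2) × unitInterval, P₂ X) :=
    (toP₂ X).comp ⟨fun p => Sum.inl (p.1.1, stretch (p.1.2, p.2)), by fun_prop⟩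
  let G₁ : C(PathSpace X × unitInterval, P₂ X) :=
    (toP₂ X).comp ⟨fun p => Sum.inr (Sum.inl p.1), by fun_prop⟩
  let G₂ : C(PathSpace X × unitInterval, P₂ X) :=
    (toP₂ X).comp ⟨fun p => Sum.inr (Sum.inr p.1), by fun_prop⟩
  -- The homotopy is built in curried form, so that the universal property of the quotient applies
  -- without having to show that the product with the interval is again a quotient.
  let G : PreJoin X → C(unitInterval, P₂ X) :=
    Sum.elim G₀.curry (Sum.elim G₁.curry G₂.curry)
  have hG : Continuous G := Continuous.sumElim G₀.curry.continuous
    (Continuous.sumElim G₁.curry.continuous G₂.curry.continuous)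
  have hglue : ∀ a b, Glue X a b → G a = G b := by
    rintro _ _ (γ | γ)
    · ext s
      -- The gluing is respected because both ends of [1, 2] stay fixed throughout the homotopy.
      have hs : stretch (⟨1, by norm_num⟩, s) = ⟨1, by norm_num⟩ := by
        apply Subtype.ext
        simp only [stretch, flat, ContinuousMap.coe_mk]
        norm_num
      change toP₂ X (Sum.inl (γ, stretch (⟨1, _⟩, s))) = _
      rw [hs]
      exact Quot.sound (Glue.left γ)
    · ext s
      have hs : stretch (⟨2, by norm_num⟩, s) = ⟨2, by norm_num⟩ := by
        apply Subtype.ext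
        simp only [stretch, flat, ContinuousMap.coe_mk]
        norm_num
        ring
      change toP₂ X (Sum.inl (γ, stretch (⟨2, _⟩, s))) = _
      rw [hs]
      exact Quot.sound (Glue.right γ)
  let F' : C(P₂ X, C(unitInterval, P₂ X)) := ⟨Quot.lift G hglue, continuous_quot_lift _ hG⟩
  refine ⟨F'.uncurry, fun y => ?_, fun y s => ?_⟩
  · obtain ⟨(⟨γ, t⟩ | γ | γ), rfl⟩ := (isQuotientMap_toP₂ X).surjective y
    · change toP₂ X (Sum.inl (γ, stretch (t, 0))) = _
      congr 3
      apply Subtype.ext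
      simp [stretch]
    · rfl
    · rfl
  · obtain ⟨(⟨γ, t⟩ | γ | γ), rfl⟩ := (isQuotientMap_toP₂ X).surjective y
    · rfl
    · change (1 : ℝ) = (1 - (s : ℝ)) * 1 + s * flat 1
      norm_num [flat]
    · change (2 : ℝ) = (1 - (s : ℝ)) * 2 + s * flat 2
      norm_num [flat]
      ring

/-- Excision for the decomposition of the double mapping cylinder into two mapping cylinders. -/
theorem exists_d_eq {A : Type v} [AddCommGroup A] (n : ℕ) (z : Cochain (P₂ X) A (n + 1))
    (h₁ : pullback (i₁ X) A (n + 1) z = 0) (h₂ : pullback (i₂ X) A (n + 1) z = 0)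
    (hz : d (P₂ X) A (n + 1) z = 0) :
    ∃ k : Cochain (P₂ X) A n, pullback (i₁ X) A n k = 0 ∧ pullback (i₂ X) A n k = 0 ∧
      d (P₂ X) A n k = z := by
  obtain ⟨F, hF₀, hF⟩ := exists_flow (X := X)
  let Z : Bool → Set (P₂ X) := fun b => bif b then Z₁ X else Z₂ X
  -- The bounds match the plateau of `flat`: it sends values up to 7/4 into (-∞, 3/2] and values
  -- from 5/4 on into [3/2, ∞).
  let U : Bool → Set (P₂ X) := fun b => bif b then q X ⁻¹' Set.Iio (7 / 4)
    else q X ⁻¹' Set.Ioi (5 / 4)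
  obtain ⟨k, hk, hdk⟩ := AffineSimplex.exists_d_eq_of_deformation (A := A) (U := U) (Z := Z)
    (by
      rintro (_ | _)
      · exact isOpen_Ioi.preimage (q X).continuous
      · exact isOpen_Iio.preimage (q X).continuous)
    (by
      intro y
      rcases lt_or_ge (q X y) (7 / 4) with h | h
      · exact ⟨true, h⟩
      · exact ⟨false, lt_of_lt_of_le (by norm_num) h⟩)
    (by
      rintro (_ | _) y hy
      · exact lt_of_lt_of_le (by norm_num) hy.1
      · exact lt_of_le_of_lt hy.2 (by norm_num))
    F hF₀
    (by
      rintro (_ | _) y hy t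
      · refine ⟨?_, q_le_two _⟩
        rw [hF]
        -- Both q and `flat q` lie on the same side of 3/2, hence so do their convex combinations.
        exact convex_Ici (3 / 2 : ℝ) (Set.mem_Ici.2 hy.1)
          (Set.mem_Ici.2 (le_flat (le_trans (by norm_num) hy.1))) (sub_nonneg.2 t.2.2) t.2.1
          (sub_add_cancel _ _)
      · refine ⟨one_le_q _, ?_⟩
        rw [hF]
        exact convex_Iic (3 / 2 : ℝ) (Set.mem_Iic.2 hy.2)
          (Set.mem_Iic.2 (flat_le (le_trans hy.2 (by norm_num)))) (sub_nonneg.2 t.2.2) t.2.1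
          (sub_add_cancel _ _))
    (by
      rintro (_ | _) y hy
      · refine ⟨?_, q_le_two _⟩
        rw [hF]
        simpa using le_flat (le_of_lt hy)
      · refine ⟨one_le_q _, ?_⟩
        rw [hF]
        simpa using flat_le (le_of_lt hy))
    (z := z)
    (by
      rintro (_ | _) σ hσ
      · exact congrFun h₂ ⟨fun t => ⟨σ t, hσ t⟩, by fun_prop⟩
      · exact congrFun h₁ ⟨fun t => ⟨σ t, hσ t⟩, by fun_prop⟩)
    hz
  exact ⟨k, funext fun σ => hk true _ fun t => (σ t).2, funext fun σ => hk false _ fun t => (σ t).2,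
    hdk⟩

end FiberwiseJoin

end

/-! ### The boundary formula -/

theorem mainTheorem4 {X : Type*} [TopologicalSpace X] {A : Type*} [AddCommGroup A] :
    ∃ δ : SingCoh.H (FiberwiseJoin.LoopSpace X) A 1 →+ SingCoh.H (FiberwiseJoin.P₂ X) A 2,
      SingCoh.IsMayerVietorisBoundary (FiberwiseJoin.ι₁ X) (FiberwiseJoin.ι₂ X)
        (FiberwiseJoin.i₁ X) (FiberwiseJoin.i₂ X) 1 δ ∧
      ∀ (c : SingCoh.cocycles X A 2) (b : SingCoh.Cochain (FiberwiseJoin.PathSpace X) A 1),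
        SingCoh.d (FiberwiseJoin.PathSpace X) A 1 b =
          SingCoh.pullback (FiberwiseJoin.endpoints X) A 2 (FiberwiseJoin.cbar c) →
        ∃ ha : SingCoh.pullback (FiberwiseJoin.r₁ X) A 1 b -
            SingCoh.pullback (FiberwiseJoin.r₂ X) A 1 b ∈
              SingCoh.cocycles (FiberwiseJoin.LoopSpace X) A 1,
          δ (SingCoh.cls ⟨SingCoh.pullback (FiberwiseJoin.r₁ X) A 1 b -
              SingCoh.pullback (FiberwiseJoin.r₂ X) A 1 b, ha⟩) =
            SingCoh.map (FiberwiseJoin.π₂ X) A 2 (SingCoh.cls (FiberwiseJoin.cbar c)) := by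
  obtain ⟨δ, hδ⟩ := SingCoh.exists_isMayerVietorisBoundary (A := A)
    (FiberwiseJoin.ι₁_injective (X := X)) Subtype.val_injective Subtype.val_injective
    (fun _ => FiberwiseJoin.exists_lift_simplex) (fun n => FiberwiseJoin.exists_d_eq n) 0
  refine ⟨δ, hδ, fun c b hb => ?_⟩
  obtain ⟨ρ₁, hρ₁, hπ₁⟩ := FiberwiseJoin.exists_retraction₁ (X := X)
  obtain ⟨ρ₂, hρ₂, hπ₂⟩ := FiberwiseJoin.exists_retraction₂ (X := X)
  have hcomp : ∀ {S T W : Type _} [TopologicalSpace S] [TopologicalSpace T] [TopologicalSpace W]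
      (g : C(T, W)) (f : C(S, T)) (n : ℕ) (e : SingCoh.Cochain W A n),
      SingCoh.pullback f A n (SingCoh.pullback g A n e) = SingCoh.pullback (g.comp f) A n e :=
    fun _ _ _ _ => rfl
  -- The two halves of a loop, the second reversed, share their end points, so the coboundaries of
  -- `r₁^* b` and `r₂^* b` cancel.
  have hr : (FiberwiseJoin.endpoints X).comp (FiberwiseJoin.r₁ X) =
      (FiberwiseJoin.endpoints X).comp (FiberwiseJoin.r₂ X) := ContinuousMap.ext fun γ =>
    (FiberwiseJoin.endpoints_r₁ γ).trans (FiberwiseJoin.endpoints_r₂ γ).symm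
  have ha : SingCoh.pullback (FiberwiseJoin.r₁ X) A 1 b -
      SingCoh.pullback (FiberwiseJoin.r₂ X) A 1 b ∈
        SingCoh.cocycles (FiberwiseJoin.LoopSpace X) A 1 := by
    change SingCoh.d _ A 1 _ = 0
    rw [map_sub, SingCoh.d_pullback, SingCoh.d_pullback, hb, hcomp, hcomp, hr, sub_self]
  -- The snake-lemma witness consists of the pullbacks of `b` along the two retractions.
  refine ⟨ha, (hδ _ _).2 ⟨⟨_, ha⟩,
    SingCoh.cocyclesMap (FiberwiseJoin.π₂ X) A 2 (FiberwiseJoin.cbar c),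
    SingCoh.pullback ρ₁ A 1 b, SingCoh.pullback ρ₂ A 1 b, rfl, rfl, ?_, ?_, ?_⟩⟩
  · rw [hcomp, hcomp, hρ₁, hρ₂]
  · rw [SingCoh.d_pullback, hb, hcomp, hπ₁]
    rfl
  · rw [SingCoh.d_pullback, hb, hcomp, hπ₂]
    rfl
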